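/- **Setting.** Let $\mathcal H,\mathcal E,\mathcal E_*$ be complex Hilbert spaces and let $U=\begin{bmatrix}A&B\\C&D\end{bmatrix}\colon \mathcal H\oplus\mathcal E\to\mathcal H\oplus\mathcal E_*$ be a *GR-unitary (Givone–Roesser unitary) colligation*: $U$ is unitary and $P_1,\dots,P_d$ are orthogonal projections on $\mathcal H$ with pairwise orthogonal ranges and $P_1+\cdots+P_d=I$. Put $Z(z)=z_1P_1+\cdots+z_dP_d$, so $Z(z)^{-1}=z_1^{-1}P_1+\cdots+z_d^{-1}P_d$. For an operator $X$ on $\mathcal H$ and $n\in\mathbb Z^d$ let $(X^\flat)^n$ be the sum of the products $P_{i_N}XP_{i_{N-1}}X\cdots P_{i_1}X$ over all words $i_N\cdots i_1$ in $\{1,\dots,d\}$ in which each letter $k$ occurs exactly $n_k$ times (so $(X^\flat)^0=I$ and $(X^\flat)^n=0$ if some $n_k<0$). All series below are formal Laurent series in $d$ commuting variables, with $(I-Z(z)A)^{-1}=\sum_n (A^\flat)^n z^n$ and $(I-Z(z)^{-1}A^*)^{-1}=\sum_n (A^{*\flat})^n z^{-n}$. Let $$H_k(z)=\begin{bmatrix}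 C(I-Z(z)A)^{-1}\\ z_k^{-1}B^*(I-Z(z)^{-1}A^*)^{-1}\end{bmatrix}P_k,\qquad K_k(z,w)=H_k(z)H_k(w)^*\quad (z_k^*=z_k^{-1},\ w_k^*=w_k^{-1}),$$ that is, $K_k(z,w)=\sum_{n,m}(H_k)_n(H_k)_m^*\,z^nw^{-m}$, and $$K=\sum_{k=1}^dK_k,\qquad K'_k(z,w)=z_kK_k(z,w)w_k^{-1},\qquad K'=\sum_{k=1}^dK'_k .$$ For a positive formal kernel $Q(z,w)=\sum Q_{n,m}z^nw^{-m}$, $\mathcal H(Q)$ is the formal reproducing kernel Hilbert space of $Q$ (the Hilbert space of formal Laurent series $f=\sum f_nz^n$ in which $\langle f,\sum_n Q_{n,m}v\,z^n\rangle=\langle f_m,v\rangle$ for all $m$, $v$). For positive kernels $Q_1,\dots,Q_d$ the *overlapping space* is $\mathcal L(Q_1,\dots,Q_d)=\{f_1\oplus\cdots\oplus f_d\in\mathcal H(Q_1)\oplus\cdots\oplus\mathcal H(Q_d): f_1+\cdots+f_d=0\}$. **Trajectories.** Write $|n|=n_1+\cdots+n_d$ for $n\in\mathbb Z^d$. Let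 $\mathcal T$ be the Hilbert space of all triples $(u,x,y)$ of functions on $\mathbb Z^d$ with values in $\mathcal E,\mathcal H,\mathcal E_*$ such that $P_kx(n+e_k)=P_kAx(n)+P_kBu(n)$ $(k=1,\dots,d)$ and $y(n)=Cx(n)+Du(n)$ for all $n$, and $$\|(u,x,y)\|^2=\sum_{|n|\ge0}\|u(n)\|^2+\sum_{|n|=0}\|x(n)\|^2+\sum_{|n|<0}\|y(n)\|^2<\infty .$$ A trajectory in $\mathcal T$ is determined by the data $u(n)$ ($|n|\ge0$), $x(n)$ ($|n|=0$), $y(n)$ ($|n|<0$), and these data can be prescribed arbitrarily subject to square-summability. The operators $\mathcal U^m(u,x,y)=(u(\cdot-m),x(\cdot-m),y(\cdot-m))$, $m\in\mathbb Z^d$, are unitary on $\mathcal T$; put $\mathcal U_k=\mathcal U^{e_k}$. Let * $\mathcal F=\{u(n)=0\text{ for }|n|\ge0,\,n\ne0;\ x(n)=0\text{ for }|n|=0;\ y(n)=0\text{ for }|n|<0\}$, * $\mathcal F_*=\{u(n)=0\text{ for }|n|\ge1;\ x(n)=0\text{ for }|n|=1;\ y(n)=0\text{ for }|n|\le0,\,n\ne0\}$,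 * $\mathcal K_{\text{scat-min}}$ the closed linear span of all $\mathcal U^n\mathcal F$ and $\mathcal U^n\mathcal F_*$, $n\in\mathbb Z^d$, * $\mathcal L_k$ the set of trajectories in $\mathcal T$ for which all of the data $u(n)$ ($|n|\ge0$), $P_jx(n)$ ($|n|=0$, $1\le j\le d$), $y(n)$ ($|n|<0$) vanish except possibly $P_kx(0)$, * $\mathcal L=\mathcal L_1\oplus\cdots\oplus\mathcal L_d$ and $\mathcal L'=\mathcal U_1\mathcal L_1\oplus\cdots\oplus\mathcal U_d\mathcal L_d$ (orthogonal sums in $\mathcal T$). For $h\in\mathcal H$ let $i_{\mathcal H}h\in\mathcal T$ be the trajectory with $x(0)=h$, $u(n)=0$ for $|n|\ge0$, $x(n)=0$ for $|n|=0$, $n\neq0$, and $y(n)=0$ for $|n|<0$; let $i'_{\mathcal H}h=\sum_{k=1}^d\mathcal U_k\,i_{\mathcal H}(P_kh)$. (These are isometries of $\mathcal H$ onto $\mathcal L$ and onto $\mathcal L'$.) The *de Branges–Rovnyak map* is $$\Pi_{dBR}\colon(u,x,y)\mapsto\begin{bmatrix}\sum_ny(n)z^n\\ \sum_nu(n)z^n\end{bmatrix}.$$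 Let $\mathcal H_{scc}$ be the closed linear span of the ranges of the operators $((A^\flat)^n)^*C^*$ and $\sum_{k=1}^d(A^\flat)^{n-e_k}P_kB$, $n\in\mathbb Z^d$ (the adjoints of the coefficients of $C(I-Z(z)A)^{-1}$ and $B^*(I-Z(z)^{-1}A^*)^{-1}Z(z)^{-1}$), and let $\mathcal H_{sscc}$ be the closed linear span of the ranges of $\sum_{k=1}^d(A^{*\flat})^{n-e_k}P_kC^*$ and $((A^{*\flat})^n)^*B$, $n\in\mathbb Z^d$ (the adjoints of the coefficients of $C(I-Z(z)A)^{-1}Z(z)$ and $B^*(I-Z(z)^{-1}A^*)^{-1}$). Put $$\mathcal L_{scc}=i_{\mathcal H}(\mathcal H_{scc}),\qquad \mathcal L_{sscc}=i'_{\mathcal H}(\mathcal H_{sscc}).$$ **Proposition.** For every GR-unitary colligation the following hold. 1. The following restrictions of $\Pi_{dBR}$ are unitary maps onto the indicated spaces: $\mathcal L_{scc}\to\mathcal H(K)$; $\ \mathcal L_k\ominus(\mathcal L_k\cap\mathcal K_{\text{scat-min}}^\perp)\to\mathcal H(K_k)$ for $k=1,\dots,d$; $\ \mathcal L_{sscc}\to\mathcal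 H(K')$; $\ \mathcal U_k\mathcal L_k\ominus(\mathcal U_k\mathcal L_k\cap\mathcal K_{\text{scat-min}}^\perp)\to\mathcal H(K'_k)$ for $k=1,\dots,d$. 2. The overlapping space $\mathcal L(K_1,\dots,K_d)$ is $\{0\}$ if and only if $\mathcal L\cap\mathcal K_{\text{scat-min}}^\perp$ is invariant under each of the orthogonal projections $P_{\mathcal L_1},\dots,P_{\mathcal L_d}$, and also if and only if $\mathcal L_{scc}$ is invariant under each of them. 3. The overlapping space $\mathcal L(K'_1,\dots,K'_d)$ is $\{0\}$ if and only if $\mathcal L'\cap\mathcal K_{\text{scat-min}}^\perp$ is invariant under each of the orthogonal projections $P_{\mathcal U_1\mathcal L_1},\dots,P_{\mathcal U_d\mathcal L_d}$, and also if and only if $\mathcal L_{sscc}$ is invariant under each of them. -/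

import Mathlib

open scoped InnerProductSpace ENNReal

namespace GivoneRoesser

noncomputable section

/-! ## Formal Laurent series and formal reproducing kernel Hilbert spaces

A formal Laurent series `∑ fₙ zⁿ` in `d` commuting variables (no restriction on the support) is
the family `n ↦ fₙ` of its coefficients, indexed by the lattice `ℤᵈ`. -/

/-- The lattice `ℤᵈ`. -/
abbrev Lat (d : ℕ) := Fin d → ℤ

/-- The standard basis vector `e_k` of `ℤᵈ`. -/
def unitVec {d : ℕ} (k : Fin d) : Lat d := Pi.single k 1

/-- `|n| = n₁ + ⋯ + n_d`. -/
def level {d : ℕ} (n : Lat d) : ℤ := ∑ k, n k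

section Kernels

variable {d : ℕ} {F : Type*} [NormedAddCommGroup F] [InnerProductSpace ℂ F] [CompleteSpace F]

/-- A positive formal kernel `K(z,w) = ∑ K_{n,m} zⁿ w⁻ᵐ` with coefficients in `𝓛(F)`. -/
structure PosKernel (d : ℕ) (F : Type*) [NormedAddCommGroup F] [InnerProductSpace ℂ F]
    [CompleteSpace F] where
  /-- the coefficients `K_{n,m}` -/
  coeff : Matrix (Lat d) (Lat d) (F →L[ℂ] F)
  posSemidef : coeff.PosSemidef

/-- `K(z,w) = G(z) G(w)*`, that is `K_{n,m} = G_n G_m*`, for a formal series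
`G(z) = ∑ G_n zⁿ` with coefficients in `𝓛(X, F)`. -/
def PosKernel.ofFactor {X : Type*} [NormedAddCommGroup X] [InnerProductSpace ℂ X]
    [CompleteSpace X] (G : Lat d → X →L[ℂ] F) : PosKernel d F where
  coeff := Matrix.of fun n m => G n ∘L (G m).adjoint
  posSemidef := by
    have h02 := (RKHS.posSemidef_tfae
      (K := Matrix.of fun n m : Lat d => G n ∘L (G m).adjoint)).out 0 2
    refine h02.mpr ⟨?_, fun v => ?_⟩
    · ext n m : 2
      simp [Matrix.conjTranspose_apply, ContinuousLinearMap.star_eq_adjoint,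
        ContinuousLinearMap.adjoint_comp]
    · have h : (v.sum fun x w => v.sum fun x' w' =>
          ⟪(Matrix.of fun n m => G n ∘L (G m).adjoint) x' x w, w'⟫_ℂ)
          = ⟪v.sum fun x w => (G x).adjoint w, v.sum fun x w => (G x).adjoint w⟫_ℂ := by
        simp only [Finsupp.sum, inner_sum, Matrix.of_apply,
          ContinuousLinearMap.comp_apply, ContinuousLinearMap.adjoint_inner_right]
        rw [Finset.sum_comm]
        simp only [map_sum, sum_inner]
      rw [h]
      exact inner_self_nonneg

/-- The sum of finitely many positive kernels. -/
def PosKernel.sum {ι : Type*} [Fintype ι] (K : ι → PosKernel d F) : PosKernel d F where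
  coeff := ∑ i, (K i).coeff
  posSemidef := by
    classical
    induction (Finset.univ : Finset ι) using Finset.induction_on with
    | empty => simpa using Matrix.PosSemidef.zero
    | insert a s ha ih => rw [Finset.sum_insert ha]; exact (K a).posSemidef.add ih

/-- The kernel `z_k K(z,w) w_k⁻¹`. -/
def PosKernel.shift (k : Fin d) (K : PosKernel d F) : PosKernel d F where
  coeff := K.coeff.submatrix (fun n => n - unitVec k) (fun m => m - unitVec k)
  posSemidef := K.posSemidef.submatrix _

instance (K : PosKernel d F) : Fact K.coeff.PosSemidef := ⟨K.posSemidef⟩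

/-- The formal reproducing kernel Hilbert space `𝓗(K)`: the Hilbert space of formal Laurent series
whose reproducing kernel is `K`. -/
def FRKHS (K : PosKernel d F) : Type _ := RKHS.OfKernel K.coeff

instance (K : PosKernel d F) : NormedAddCommGroup (FRKHS K) :=
  inferInstanceAs (NormedAddCommGroup (RKHS.OfKernel K.coeff))

instance (K : PosKernel d F) : InnerProductSpace ℂ (FRKHS K) :=
  inferInstanceAs (InnerProductSpace ℂ (RKHS.OfKernel K.coeff))

instance (K : PosKernel d F) : CompleteSpace (FRKHS K) :=
  inferInstanceAs (CompleteSpace (RKHS.OfKernel K.coeff))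

instance (K : PosKernel d F) : RKHS ℂ (FRKHS K) (Lat d) F :=
  inferInstanceAs (RKHS ℂ (RKHS.OfKernel K.coeff) (Lat d) F)

theorem kernel_FRKHS (K : PosKernel d F) : RKHS.kernel (FRKHS K) = K.coeff :=
  RKHS.OfKernel.kernel_ofKernel

/-- The sum map `⊕ f_j ↦ ∑ f_j` from the external orthogonal direct sum of the `𝓗(K_j)` to formal
Laurent series. -/
def sumMap {ι : Type*} [Fintype ι] (K : ι → PosKernel d F) :
    PiLp 2 (fun j => FRKHS (K j)) →ₗ[ℂ] (Lat d → F) where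
  toFun f := ∑ j, ⇑(f j)
  map_add' f g := by simp [Finset.sum_add_distrib]
  map_smul' c f := by simp [Finset.smul_sum]

/-- The overlapping space `𝓛(K₁, …, K_d)`, the kernel of the sum map, inside the external
orthogonal direct sum of the `𝓗(K_j)`. -/
def overlappingSpace {ι : Type*} [Fintype ι] (K : ι → PosKernel d F) :
    Submodule ℂ (PiLp 2 (fun j => FRKHS (K j))) :=
  LinearMap.ker (sumMap K)

end Kernels

/-! ## Givone--Roesser unitary colligations -/

/-- A Givone--Roesser unitary colligation in coordinate-free form: a unitary operator
`U = [A B; C D] : H ⊕ E → H ⊕ E_*` together with orthogonal projections `P₁, …, P_d` on `H` with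
pairwise orthogonal ranges spanning `H`. -/
structure Colligation (d : ℕ) (H E Es : Type*)
    [NormedAddCommGroup H] [InnerProductSpace ℂ H] [CompleteSpace H]
    [NormedAddCommGroup E] [InnerProductSpace ℂ E] [CompleteSpace E]
    [NormedAddCommGroup Es] [InnerProductSpace ℂ Es] [CompleteSpace Es] where
  U : WithLp 2 (H × E) ≃ₗᵢ[ℂ] WithLp 2 (H × Es)
  P : Fin d → H →L[ℂ] H
  isStarProjection (k : Fin d) : IsStarProjection (P k)
  mul_eq_zero {j k : Fin d} (hjk : j ≠ k) : P j * P k = 0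
  sum_eq_one : ∑ k, P k = 1

/-- The operator `x ↦ (S x, T x)` into the orthogonal direct sum. -/
def pairL {X Y Z : Type*} [NormedAddCommGroup X] [InnerProductSpace ℂ X]
    [NormedAddCommGroup Y] [InnerProductSpace ℂ Y] [NormedAddCommGroup Z] [InnerProductSpace ℂ Z]
    (S : X →L[ℂ] Y) (T : X →L[ℂ] Z) : X →L[ℂ] WithLp 2 (Y × Z) :=
  (WithLp.prodContinuousLinearEquiv 2 ℂ Y Z).symm.toContinuousLinearMap ∘L S.prod T

namespace Colligation

variable {d : ℕ} {H E Es : Type*}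
  [NormedAddCommGroup H] [InnerProductSpace ℂ H] [CompleteSpace H]
  [NormedAddCommGroup E] [InnerProductSpace ℂ E] [CompleteSpace E]
  [NormedAddCommGroup Es] [InnerProductSpace ℂ Es] [CompleteSpace Es]
  (c : Colligation d H E Es)

/-- `U` as a bounded operator. -/
def UL : WithLp 2 (H × E) →L[ℂ] WithLp 2 (H × Es) := c.U.toLinearIsometry.toContinuousLinearMap

/-- The state operator `A`. -/
def A : H →L[ℂ] H := WithLp.fstL 2 ℂ H Es ∘L c.UL ∘L pairL (.id ℂ H) 0

/-- The input operator `B`. -/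
def B : E →L[ℂ] H := WithLp.fstL 2 ℂ H Es ∘L c.UL ∘L pairL 0 (.id ℂ E)

/-- The output operator `C`. -/
def C : H →L[ℂ] Es := WithLp.sndL 2 ℂ H Es ∘L c.UL ∘L pairL (.id ℂ H) 0

/-- The feedthrough operator `D`. -/
def D : E →L[ℂ] Es := WithLp.sndL 2 ℂ H Es ∘L c.UL ∘L pairL 0 (.id ℂ E)

theorem U_apply (h : H) (e : E) :
    c.U (WithLp.toLp 2 (h, e)) = WithLp.toLp 2 (c.A h + c.B e, c.C h + c.D e) := by
  have h1 : (WithLp.toLp 2 (h, e) : WithLp 2 (H × E))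
      = WithLp.toLp 2 (h, 0) + WithLp.toLp 2 (0, e) := by
    rw [← WithLp.toLp_add]; simp
  rw [h1, map_add]
  rfl

/-! ### Formal power series attached to the colligation -/

/-- The abelianization `w ↦ (#1's in w, …, #d's in w)` of a word in the letters `1, …, d`. -/
def abelianize (w : List (Fin d)) : Lat d := fun k => (w.count k : ℤ)

/-- `(X^♭)ⁿ = ∑ P_{i_N} X P_{i_{N-1}} X ⋯ P_{i_1} X`, the sum over all words `i_N ⋯ i_1` whose
abelianization is `n` (so it is zero when `n` has a negative entry). As formal series,
`(I - Z(z) X)⁻¹ = ∑ (X^♭)ⁿ zⁿ` and `(I - Z(z)⁻¹ X)⁻¹ = ∑ (X^♭)ⁿ z⁻ⁿ`, where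
`Z(z) = z₁ P₁ + ⋯ + z_d P_d`. -/
def abPow (X : H →L[ℂ] H) (n : Lat d) : H →L[ℂ] H :=
  ∑ᶠ w ∈ {w : List (Fin d) | abelianize w = n}, (w.map fun i => c.P i * X).prod

/-- The coefficient of `zⁿ` in the formal Laurent series
`H_k(z) = [C (I - Z(z) A)⁻¹ ; z_k⁻¹ B* (I - Z(z)⁻¹ A*)⁻¹] P_k`. -/
def Hcoeff (k : Fin d) (n : Lat d) : H →L[ℂ] WithLp 2 (Es × E) :=
  pairL (c.C ∘L c.abPow c.A n)
    (c.B.adjoint ∘L c.abPow c.A.adjoint (-(n + unitVec k))) ∘L c.P k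

/-- `K_k(z,w) = H_k(z) H_k(w)*`. -/
def Kk (k : Fin d) : PosKernel d (WithLp 2 (Es × E)) := PosKernel.ofFactor (c.Hcoeff k)

/-- `K(z,w) = ∑ K_k(z,w)`. -/
def Ksum : PosKernel d (WithLp 2 (Es × E)) := PosKernel.sum c.Kk

/-- `K'_k(z,w) = z_k K_k(z,w) w_k⁻¹`. -/
def Kk' (k : Fin d) : PosKernel d (WithLp 2 (Es × E)) := (c.Kk k).shift k

/-- `K'(z,w) = ∑ K'_k(z,w)`. -/
def Ksum' : PosKernel d (WithLp 2 (Es × E)) := PosKernel.sum c.Kk'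

/-- `𝓗_scc`: the closed linear span of the ranges of the adjoints of the coefficients of
`C (I - Z(z) A)⁻¹` (these are the `((A^♭)ⁿ)* C*`) and of
`B* (I - Z(z)⁻¹ A*)⁻¹ Z(z)⁻¹` (these are the `∑_k (A^♭)^(n - e_k) P_k B`). -/
def Hscc : Submodule ℂ H :=
  (⨆ n : Lat d, LinearMap.range ((c.abPow c.A n).adjoint ∘L c.C.adjoint).toLinearMap ⊔
    LinearMap.range
      ((∑ k, c.abPow c.A (n - unitVec k) ∘L c.P k) ∘L c.B).toLinearMap).topologicalClosure

/-- `𝓗_sscc`: the closed linear span of the ranges of the adjoints of the coefficients of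
`C (I - Z(z) A)⁻¹ Z(z)` (these are the `∑_k (A*^♭)^(n - e_k) P_k C*`) and of
`B* (I - Z(z)⁻¹ A*)⁻¹` (these are the `((A*^♭)ⁿ)* B`). -/
def Hsscc : Submodule ℂ H :=
  (⨆ n : Lat d, LinearMap.range
      ((∑ k, c.abPow c.A.adjoint (n - unitVec k) ∘L c.P k) ∘L c.C.adjoint).toLinearMap ⊔
    LinearMap.range ((c.abPow c.A.adjoint n).adjoint ∘L c.B).toLinearMap).topologicalClosure

/-! ### Trajectories

A trajectory is a triple `(u, x, y)` of functions on `ℤᵈ`. -/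

/-- The space of all triples `(u, x, y)` of functions on `ℤᵈ` with values in `E`, `H`, `E_*`. -/
abbrev Signal (d : ℕ) (H E Es : Type*) := (Lat d → E) × (Lat d → H) × (Lat d → Es)

/-- The trajectories of the system
`P_k x(n + e_k) = P_k A x(n) + P_k B u(n)` for `k = 1, …, d`, `y(n) = C x(n) + D u(n)`. -/
def trajectories : Submodule ℂ (Signal d H E Es) where
  carrier := {t | ∀ n, (∀ k, c.P k (t.2.1 (n + unitVec k)) =
      c.P k (c.A (t.2.1 n)) + c.P k (c.B (t.1 n))) ∧
    t.2.2 n = c.C (t.2.1 n) + c.D (t.1 n)}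
  add_mem' {s t} hs ht n := by
    refine ⟨fun k => ?_, ?_⟩
    · simp only [Prod.snd_add, Prod.fst_add, Pi.add_apply, map_add, (hs n).1 k, (ht n).1 k]
      abel
    · simp only [Prod.snd_add, Prod.fst_add, Pi.add_apply, map_add, (hs n).2, (ht n).2]
      abel
  zero_mem' n := by simp
  smul_mem' a t ht n := by
    refine ⟨fun k => ?_, ?_⟩
    · simp only [Prod.smul_snd, Prod.smul_fst, Pi.smul_apply, map_smul, (ht n).1 k, smul_add]
    · simp only [Prod.smul_snd, Prod.smul_fst, Pi.smul_apply, map_smul, (ht n).2, smul_add]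

theorem P_P_apply (j k : Fin d) (h : H) : c.P j (c.P k h) = if j = k then c.P k h else 0 := by
  have h1 : c.P j (c.P k h) = (c.P j * c.P k) h := rfl
  rw [h1]
  split_ifs with hjk
  · subst hjk
    rw [(c.isStarProjection j).isIdempotentElem.eq]
  · rw [c.mul_eq_zero hjk]; rfl

theorem sum_P_apply (h : H) : ∑ k, c.P k h = h := by
  have := congrArg (fun T : H →L[ℂ] H => T h) c.sum_eq_one
  simpa [sum_apply] using this

/-- The vector `∑ P_k x(n + e_k)` of shifted state components. -/
def next (x : Lat d → H) (n : Lat d) : H := ∑ k, c.P k (x (n + unitVec k))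

theorem P_next (x : Lat d → H) (n : Lat d) (k : Fin d) :
    c.P k (c.next x n) = c.P k (x (n + unitVec k)) := by
  simp [next, map_sum, P_P_apply]

theorem sum_P_next (x : Lat d → H) (m : Lat d) : ∑ k, c.P k (c.next x (m - unitVec k)) = x m := by
  simp only [P_next, sub_add_cancel, sum_P_apply]

/-- The system equations at `n` say `U (x(n), u(n)) = (∑ P_k x(n + e_k), y(n))`. -/
theorem mem_trajectories_iff (t : Signal d H E Es) : t ∈ c.trajectories ↔
    ∀ n, c.U (WithLp.toLp 2 (t.2.1 n, t.1 n)) = WithLp.toLp 2 (c.next t.2.1 n, t.2.2 n) := by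
  refine forall_congr' fun n => ?_
  rw [U_apply]
  constructor
  · rintro ⟨h1, h2⟩
    rw [h2, ← c.sum_P_apply (c.A _ + c.B _)]
    simp only [map_add, ← h1]
    rfl
  · intro h
    have h1 := congrArg WithLp.fst h
    have h2 := congrArg WithLp.snd h
    simp only [WithLp.toLp_fst, WithLp.toLp_snd] at h1 h2
    refine ⟨fun k => ?_, h2.symm⟩
    rw [← map_add, h1, P_next]

theorem level_add (m n : Lat d) : level (m + n) = level m + level n := by
  simp [level, Finset.sum_add_distrib]

theorem level_sub (m n : Lat d) : level (m - n) = level m - level n := by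
  simp [level, Finset.sum_sub_distrib]

theorem level_unitVec (k : Fin d) : level (unitVec k : Lat d) = 1 := by
  simp [level, unitVec]

/-! ### Energy

The balanced shift-invariant sublattices are `Ω_s = {n | s ≤ |n|}`. Every line in a coordinate
direction meets `Ω_s` and its complement, so the boundary of `Ω_s` has no part at infinity, and all
its finite boundary parts `∂_k` are equal to `{n | |n| = s}`. -/

/-- `‖u|Ω_s‖² + ‖x|∂Ω_s‖² + ‖y|ℤᵈ∖Ω_s‖²`, with values in `[0, ∞]`. -/
def energy (s : ℤ) (t : Signal d H E Es) : ℝ≥0∞ :=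
  (∑' n : {n : Lat d // s ≤ level n}, ‖t.1 n‖ₑ ^ 2) +
  (∑' n : {n : Lat d // level n = s}, ‖t.2.1 n‖ₑ ^ 2) +
  ∑' n : {n : Lat d // level n < s}, ‖t.2.2 n‖ₑ ^ 2

theorem norm_sq_eq_sum (h : H) : ‖h‖ₑ ^ 2 = ∑ k, ‖c.P k h‖ₑ ^ 2 := by
  have key : ‖h‖ ^ 2 = ∑ k, ‖c.P k h‖ ^ 2 := by
    have h1 : ∀ k, ⟪h, c.P k h⟫_ℂ = ⟪c.P k h, c.P k h⟫_ℂ := fun k => by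
      have hsa : (c.P k).adjoint = c.P k := (c.isStarProjection k).isSelfAdjoint
      rw [← ContinuousLinearMap.adjoint_inner_right, hsa, c.P_P_apply, if_pos rfl]
    have h2 : ⟪h, h⟫_ℂ = ∑ k, ⟪c.P k h, c.P k h⟫_ℂ := by
      conv_lhs => rw [← c.sum_P_apply h]
      conv_lhs => arg 3; rw [c.sum_P_apply h]
      rw [sum_inner]
      refine Finset.sum_congr rfl fun k _ => ?_
      rw [← inner_conj_symm, h1, inner_conj_symm]
    simp only [inner_self_eq_norm_sq_to_K] at h2
    exact_mod_cast h2
  simp only [← ofReal_norm, ← ENNReal.ofReal_pow (norm_nonneg _)]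
  rw [key, ENNReal.ofReal_sum_of_nonneg (fun _ _ => by positivity)]

theorem enorm_sq_prod {X Y : Type*} [NormedAddCommGroup X] [NormedAddCommGroup Y] (a : X) (b : Y) :
    ‖(WithLp.toLp 2 (a, b) : WithLp 2 (X × Y))‖ₑ ^ 2 = ‖a‖ₑ ^ 2 + ‖b‖ₑ ^ 2 := by
  have h := WithLp.prod_norm_sq_eq_of_L2 (WithLp.toLp 2 (a, b) : WithLp 2 (X × Y))
  simp only [WithLp.toLp_fst, WithLp.toLp_snd] at h
  simp only [← ofReal_norm, ← ENNReal.ofReal_pow (norm_nonneg _)]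
  rw [h, ENNReal.ofReal_add (by positivity) (by positivity)]

theorem tsum_split {X : Type*} {p q r : X → Prop} (h : ∀ n, p n ↔ q n ∨ r n)
    (hd : ∀ n, q n → ¬ r n) (f : X → ℝ≥0∞) :
    ∑' n : {n // p n}, f n = ∑' n : {n // q n}, f n + ∑' n : {n // r n}, f n := by
  classical
  have e : ∀ p : X → Prop, ∑' n : {n // p n}, f n = ∑' n, if p n then f n else 0 := fun p => by
    rw [show (∑' n : {n // p n}, f n) = ∑' n, Set.indicator {n | p n} f n from
      tsum_subtype {n | p n} f]
    rfl
  rw [e, e, e, ← ENNReal.tsum_add]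
  refine tsum_congr fun n => ?_
  by_cases hq : q n
  · simp [(h n).2 (Or.inl hq), hq, hd n hq]
  · by_cases hr : r n
    · simp [(h n).2 (Or.inr hr), hq, hr]
    · simp [(h n).not.2 (by tauto), hq, hr]

theorem tsum_next (x : Lat d → H) (s : ℤ) :
    ∑' n : {n : Lat d // level n = s}, ‖c.next x n‖ₑ ^ 2 =
      ∑' n : {n : Lat d // level n = s + 1}, ‖x n‖ₑ ^ 2 := by
  rw [tsum_congr fun n : {n : Lat d // level n = s} => c.norm_sq_eq_sum _,
    tsum_congr fun n : {n : Lat d // level n = s + 1} => c.norm_sq_eq_sum _]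
  simp only [P_next]
  rw [Summable.tsum_finsetSum (fun _ _ => ENNReal.summable),
    Summable.tsum_finsetSum (fun _ _ => ENNReal.summable)]
  refine Finset.sum_congr rfl fun k _ => ?_
  let e : {n : Lat d // level n = s} ≃ {n : Lat d // level n = s + 1} :=
    (Equiv.addRight (unitVec k)).subtypeEquiv fun n => by
      simp [level_add, level_unitVec]
  exact e.tsum_eq (fun n : {n : Lat d // level n = s + 1} => ‖c.P k (x n)‖ₑ ^ 2)

theorem energy_succ {t : Signal d H E Es} (ht : t ∈ c.trajectories) (s : ℤ) :
    energy s t = energy (s + 1) t := by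
  have h1 := tsum_split (p := fun n : Lat d => s ≤ level n) (q := fun n => level n = s)
    (r := fun n => s + 1 ≤ level n) (fun n => by grind) (fun n => by grind)
    (fun n => ‖t.1 n‖ₑ ^ 2)
  have h2 := tsum_split (p := fun n : Lat d => level n < s + 1) (q := fun n => level n = s)
    (r := fun n => level n < s) (fun n => by grind) (fun n => by grind)
    (fun n => ‖t.2.2 n‖ₑ ^ 2)
  have h3 : (∑' n : {n : Lat d // level n = s}, ‖t.2.1 n‖ₑ ^ 2) +
      (∑' n : {n : Lat d // level n = s}, ‖t.1 n‖ₑ ^ 2) =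
      (∑' n : {n : Lat d // level n = s + 1}, ‖t.2.1 n‖ₑ ^ 2) +
      ∑' n : {n : Lat d // level n = s}, ‖t.2.2 n‖ₑ ^ 2 := by
    rw [← c.tsum_next, ← ENNReal.tsum_add, ← ENNReal.tsum_add]
    refine tsum_congr fun n => ?_
    rw [← enorm_sq_prod, ← enorm_sq_prod, ← (c.mem_trajectories_iff t).1 ht n]
    simp only [← ofReal_norm, LinearIsometryEquiv.norm_map]
  simp only [energy]
  rw [h1, h2]
  calc _ = ((∑' n : {n : Lat d // level n = s}, ‖t.2.1 n‖ₑ ^ 2) +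
      (∑' n : {n : Lat d // level n = s}, ‖t.1 n‖ₑ ^ 2)) +
      (∑' n : {n : Lat d // s + 1 ≤ level n}, ‖t.1 n‖ₑ ^ 2) +
      ∑' n : {n : Lat d // level n < s}, ‖t.2.2 n‖ₑ ^ 2 := by ring
    _ = _ := by rw [h3]; ring

/-- The energy of a trajectory does not depend on the chosen balanced sublattice. -/
theorem energy_eq {t : Signal d H E Es} (ht : t ∈ c.trajectories) (s s' : ℤ) :
    energy s t = energy s' t := by
  have h0 : ∀ s, energy s t = energy 0 t := fun s => by
    induction s using Int.induction_on with
    | zero => rfl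
    | succ i ih => rw [← c.energy_succ ht, ih]
    | pred i ih => rw [c.energy_succ ht, sub_add_cancel, ih]
  rw [h0 s, h0 s']

/-! ### The Hilbert space of admissible trajectories -/

theorem memlp_iff {X Y : Type*} [NormedAddCommGroup Y] (f : X → Y) :
    Memℓp f 2 ↔ ∑' n, ‖f n‖ₑ ^ 2 ≠ ∞ := by
  rw [memℓp_gen_iff (by simp)]
  simp only [ENNReal.toReal_ofNat, Real.rpow_ofNat, ← ofReal_norm,
    ← ENNReal.ofReal_pow (norm_nonneg _)]
  constructor
  · intro h
    exact h.tsum_ofReal_ne_top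
  · intro h
    exact (ENNReal.summable_toReal h).congr fun n => by
      rw [ENNReal.toReal_ofReal (by positivity)]

theorem enorm_sq_lp {X Y : Type*} [NormedAddCommGroup Y] (f : lp (fun _ : X => Y) 2) :
    ‖f‖ₑ ^ 2 = ∑' n, ‖f n‖ₑ ^ 2 := by
  have h := lp.norm_rpow_eq_tsum (p := 2) (by simp) f
  have hs := (memℓp_gen_iff (p := 2) (by simp)).1 (lp.memℓp f)
  simp only [ENNReal.toReal_ofNat, Real.rpow_ofNat] at h hs
  simp only [← ofReal_norm, ← ENNReal.ofReal_pow (norm_nonneg _)]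
  rw [h, ENNReal.ofReal_tsum_of_nonneg (fun _ => by positivity) hs]

/-- The admissible trajectories: those of finite energy. -/
def admissible : Submodule ℂ (Signal d H E Es) where
  carrier := {t | t ∈ c.trajectories ∧ energy 0 t ≠ ∞}
  add_mem' {s t} hs ht := by
    refine ⟨add_mem hs.1 ht.1, ?_⟩
    have h1 := hs.2
    have h2 := ht.2
    simp only [energy, ENNReal.add_ne_top] at h1 h2 ⊢
    refine ⟨⟨?_, ?_⟩, ?_⟩
    · exact (memlp_iff _).1 (((memlp_iff _).2 h1.1.1).add ((memlp_iff _).2 h2.1.1))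
    · exact (memlp_iff _).1 (((memlp_iff _).2 h1.1.2).add ((memlp_iff _).2 h2.1.2))
    · exact (memlp_iff _).1 (((memlp_iff _).2 h1.2).add ((memlp_iff _).2 h2.2))
  zero_mem' := ⟨zero_mem _, by simp [energy]⟩
  smul_mem' a t ht := by
    refine ⟨Submodule.smul_mem _ a ht.1, ?_⟩
    have h1 := ht.2
    simp only [energy, ENNReal.add_ne_top] at h1 ⊢
    refine ⟨⟨?_, ?_⟩, ?_⟩
    · exact (memlp_iff _).1 (((memlp_iff _).2 h1.1.1).const_smul a)
    · exact (memlp_iff _).1 (((memlp_iff _).2 h1.1.2).const_smul a)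
    · exact (memlp_iff _).1 (((memlp_iff _).2 h1.2).const_smul a)

/-- The space `𝓣` of admissible trajectories. -/
def Traj : Type _ := ↥c.admissible

instance : AddCommGroup c.Traj := inferInstanceAs (AddCommGroup ↥c.admissible)

instance : Module ℂ c.Traj := inferInstanceAs (Module ℂ ↥c.admissible)

/-- The inclusion of `𝓣` into the space of all triples `(u, x, y)`. -/
def Traj.signal : c.Traj →ₗ[ℂ] Signal d H E Es := c.admissible.subtype

/-- The input string `u` of an admissible trajectory. -/
def Traj.u {c : Colligation d H E Es} (t : c.Traj) : Lat d → E := (Traj.signal c t).1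

/-- The state string `x` of an admissible trajectory. -/
def Traj.x {c : Colligation d H E Es} (t : c.Traj) : Lat d → H := (Traj.signal c t).2.1

/-- The output string `y` of an admissible trajectory. -/
def Traj.y {c : Colligation d H E Es} (t : c.Traj) : Lat d → Es := (Traj.signal c t).2.2

/-- Coordinates of admissible trajectories with respect to the balanced sublattice `Ω = Ω_0`:
`ℓ²(Ω, E) ⊕ ℓ²(∂Ω, H) ⊕ ℓ²(ℤᵈ∖Ω, E_*)`. -/
abbrev BoundaryData (d : ℕ) (H E Es : Type*) [NormedAddCommGroup H] [NormedAddCommGroup E]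
    [NormedAddCommGroup Es] :=
  WithLp 2 (lp (fun _ : {n : Lat d // 0 ≤ level n} => E) 2 ×
    WithLp 2 (lp (fun _ : {n : Lat d // level n = 0} => H) 2 ×
      lp (fun _ : {n : Lat d // level n < 0} => Es) 2))

theorem Traj.memlp_u (t : c.Traj) : Memℓp (fun n : {n : Lat d // 0 ≤ level n} => t.u n) 2 := by
  have h := t.2.2
  simp only [energy, ENNReal.add_ne_top] at h
  exact (memlp_iff _).2 h.1.1

theorem Traj.memlp_x (t : c.Traj) : Memℓp (fun n : {n : Lat d // level n = 0} => t.x n) 2 := by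
  have h := t.2.2
  simp only [energy, ENNReal.add_ne_top] at h
  exact (memlp_iff _).2 h.1.2

theorem Traj.memlp_y (t : c.Traj) : Memℓp (fun n : {n : Lat d // level n < 0} => t.y n) 2 := by
  have h := t.2.2
  simp only [energy, ENNReal.add_ne_top] at h
  exact (memlp_iff _).2 h.2

/-- The map `(u, x, y) ↦ (u|Ω, x|∂Ω, y|ℤᵈ∖Ω)`. -/
def Gamma : c.Traj →ₗ[ℂ] BoundaryData d H E Es where
  toFun t := WithLp.toLp 2 (⟨_, t.memlp_u⟩, WithLp.toLp 2 (⟨_, t.memlp_x⟩, ⟨_, t.memlp_y⟩))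
  map_add' _ _ := rfl
  map_smul' _ _ := rfl

theorem enorm_Gamma (t : c.Traj) : ‖c.Gamma t‖ₑ ^ 2 = energy 0 (Traj.signal c t) := by
  have h : c.Gamma t = WithLp.toLp 2 (⟨_, t.memlp_u⟩,
    WithLp.toLp 2 (⟨_, t.memlp_x⟩, ⟨_, t.memlp_y⟩)) := rfl
  rw [h, enorm_sq_prod, enorm_sq_prod, enorm_sq_lp, enorm_sq_lp, enorm_sq_lp, energy, add_assoc]
  rfl

/-! The initial value problem with data on `Ω`, `∂Ω`, `ℤᵈ∖Ω` is uniquely solvable. -/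

theorem Gamma_injective : Function.Injective c.Gamma := by
  rw [← LinearMap.ker_eq_bot, LinearMap.ker_eq_bot']
  intro t ht
  have hu : ∀ n, 0 ≤ level n → t.u n = 0 := fun n hn =>
    congrFun (congrArg Subtype.val (congrArg WithLp.fst ht)) ⟨n, hn⟩
  have hx : ∀ n, level n = 0 → t.x n = 0 := fun n hn =>
    congrFun (congrArg Subtype.val (congrArg WithLp.fst (congrArg WithLp.snd ht))) ⟨n, hn⟩
  have hy : ∀ n, level n < 0 → t.y n = 0 := fun n hn =>
    congrFun (congrArg Subtype.val (congrArg WithLp.snd (congrArg WithLp.snd ht))) ⟨n, hn⟩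
  have heq : ∀ n, c.U (WithLp.toLp 2 (t.x n, t.u n)) = WithLp.toLp 2 (c.next t.x n, t.y n) :=
    (c.mem_trajectories_iff _).1 t.2.1
  have fwd : ∀ (s : ℕ) n, level n = s → t.x n = 0 := by
    intro s
    induction s with
    | zero => exact fun n hn => hx n (by simpa using hn)
    | succ s ih =>
      intro n hn
      rw [← c.sum_P_next t.x n]
      refine Finset.sum_eq_zero fun k _ => ?_
      have hl : level (n - unitVec k) = s := by
        rw [level_sub, hn, level_unitVec]; push_cast; ring
      have h := heq (n - unitVec k)
      rw [ih _ hl, hu _ (by omega), show WithLp.toLp 2 ((0 : H), (0 : E)) = 0 from rfl,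
        map_zero] at h
      rw [show c.next t.x (n - unitVec k) = 0 from (congrArg WithLp.fst h).symm, map_zero]
  have bwd : ∀ (s : ℕ) n, level n = -s → t.x n = 0 ∧ (level n < 0 → t.u n = 0) := by
    intro s
    induction s with
    | zero => exact fun n hn => ⟨hx n (by simpa using hn), fun h => by simp [hn] at h⟩
    | succ s ih =>
      intro n hn
      have hnx : c.next t.x n = 0 := by
        refine Finset.sum_eq_zero fun k _ => ?_
        rw [(ih _ (by rw [level_add, hn, level_unitVec]; push_cast; ring)).1, map_zero]
      have h := heq n
      rw [hnx, hy n (by rw [hn]; push_cast; omega),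
        show WithLp.toLp 2 ((0 : H), (0 : Es)) = 0 from rfl, map_eq_zero_iff _ c.U.injective] at h
      exact ⟨congrArg WithLp.fst h, fun _ => congrArg WithLp.snd h⟩
  have hx' : ∀ n, t.x n = 0 := fun n => by
    rcases le_total 0 (level n) with h | h
    · exact fwd (level n).toNat n (by omega)
    · exact (bwd (-level n).toNat n (by omega)).1
  have hu' : ∀ n, t.u n = 0 := fun n => by
    rcases le_or_gt 0 (level n) with h | h
    · exact hu n h
    · exact (bwd (-level n).toNat n (by omega)).2 h
  have hy' : ∀ n, t.y n = 0 := fun n => by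
    have h := heq n
    rw [hx', hu', show WithLp.toLp 2 ((0 : H), (0 : E)) = 0 from rfl, map_zero] at h
    exact (congrArg WithLp.snd h).symm
  exact Subtype.ext (Prod.ext (funext hu') (Prod.ext (funext hx') (funext hy')))

/-- Forward recursion for the state. -/
def fwdState (u : Lat d → E) (x : Lat d → H) : ℕ → Lat d → H
  | 0 => x
  | s + 1 => fun m => ∑ k, c.P k (c.U (WithLp.toLp 2
      (fwdState u x s (m - unitVec k), u (m - unitVec k)))).fst

/-- Backward recursion for the state. -/
def bwdState (y : Lat d → Es) (x : Lat d → H) : ℕ → Lat d → H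
  | 0 => x
  | s + 1 => fun n => (c.U.symm (WithLp.toLp 2 (c.next (bwdState y x s) n, y n))).fst

theorem exists_trajectory (u : Lat d → E) (x : Lat d → H) (y : Lat d → Es) :
    ∃ t ∈ c.trajectories, (∀ n, 0 ≤ level n → t.1 n = u n) ∧
      (∀ n, level n = 0 → t.2.1 n = x n) ∧ ∀ n, level n < 0 → t.2.2 n = y n := by
  let X : Lat d → H := fun n => if 0 ≤ level n then c.fwdState u x (level n).toNat n
    else c.bwdState y x (-level n).toNat n
  have hXf : ∀ (s : ℕ) n, level n = s → X n = c.fwdState u x s n := fun s n hn => by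
    simp [X, hn]
  have hXb : ∀ (s : ℕ) n, level n = -s → X n = c.bwdState y x s n := fun s n hn => by
    rcases Nat.eq_zero_or_pos s with rfl | hs
    · simp [X, hn, fwdState, bwdState]
    · have : ¬ (0 ≤ level n) := by omega
      simp only [X, if_neg this, hn, neg_neg, Int.toNat_natCast]
  let u' : Lat d → E := fun n => if 0 ≤ level n then u n
    else (c.U.symm (WithLp.toLp 2 (c.next X n, y n))).snd
  let y' : Lat d → Es := fun n => if 0 ≤ level n then (c.U (WithLp.toLp 2 (X n, u n))).snd
    else y n
  refine ⟨(u', X, y'), (c.mem_trajectories_iff _).2 fun n => ?_, fun n hn => if_pos hn,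
    fun n hn => ?_, fun n hn => if_neg (by omega)⟩
  · rcases le_or_gt 0 (level n) with h | h
    · obtain ⟨s, hs⟩ := Int.eq_ofNat_of_zero_le h
      have hnext : c.next X n = (c.U (WithLp.toLp 2 (X n, u n))).fst := by
        have h1 : ∀ k, c.P k (X (n + unitVec k)) =
            c.P k (c.U (WithLp.toLp 2 (X n, u n))).fst := fun k => by
          rw [hXf (s + 1) _ (by rw [level_add, hs, level_unitVec]; push_cast; ring)]
          simp only [fwdState, map_sum, P_P_apply]
          simp [hXf s n hs]
        simp only [next, h1, sum_P_apply]
      simp only [u', y', if_pos h, hnext]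
      rfl
    · have hn' : ¬ (0 ≤ level n) := by omega
      obtain ⟨s, hs⟩ : ∃ s : ℕ, level n = -((s + 1 : ℕ) : ℤ) :=
        ⟨(-level n - 1).toNat, by omega⟩
      have hX : X n = (c.U.symm (WithLp.toLp 2 (c.next X n, y n))).fst := by
        rw [hXb (s + 1) n hs]
        have : c.next X n = c.next (c.bwdState y x s) n := by
          refine Finset.sum_congr rfl fun k _ => ?_
          rw [hXb s _ (by rw [level_add, hs, level_unitVec]; push_cast; ring)]
        rw [this]
        rfl
      have hz : (WithLp.toLp 2 (X n, (c.U.symm (WithLp.toLp 2 (c.next X n, y n))).snd) :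
          WithLp 2 (H × E)) = c.U.symm (WithLp.toLp 2 (c.next X n, y n)) :=
        congrArg (fun h : H => (WithLp.toLp 2 (h, _) : WithLp 2 (H × E))) hX
      simp only [u', y', if_neg hn']
      rw [hz, LinearIsometryEquiv.apply_symm_apply]
  · exact hXf 0 n (by simpa using hn)

/-! ### The Hilbert space `𝓣` -/

instance : NormedAddCommGroup c.Traj :=
  NormedAddCommGroup.induced c.Traj (BoundaryData d H E Es) c.Gamma c.Gamma_injective

/-- The inner product of `𝓣`, for which `Γ` is isometric:
`‖(u, x, y)‖² = ‖u|Ω‖² + ‖x|∂Ω‖² + ‖y|ℤᵈ∖Ω‖²`. By conservation of energy this does not depend on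
the choice of the balanced sublattice `Ω`, see `enorm_sq_eq_energy`. -/
instance : InnerProductSpace ℂ c.Traj where
  toNormedSpace := NormedSpace.induced ℂ c.Traj (BoundaryData d H E Es) c.Gamma
  inner s t := ⟪c.Gamma s, c.Gamma t⟫_ℂ
  norm_sq_eq_re_inner t := norm_sq_eq_re_inner (𝕜 := ℂ) (c.Gamma t)
  conj_inner_symm s t := inner_conj_symm (c.Gamma s) (c.Gamma t)
  add_left s t r := by rw [map_add, inner_add_left]
  smul_left s t a := by rw [map_smul, inner_smul_left]

theorem Gamma_surjective : Function.Surjective c.Gamma := by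
  intro b
  let v := b.fst
  let ξ := b.snd.fst
  let η := b.snd.snd
  obtain ⟨t, ht, htu, htx, hty⟩ := c.exists_trajectory
    (fun n => if h : 0 ≤ level n then v ⟨n, h⟩ else 0)
    (fun n => if h : level n = 0 then ξ ⟨n, h⟩ else 0)
    (fun n => if h : level n < 0 then η ⟨n, h⟩ else 0)
  have hu : (fun n : {n : Lat d // 0 ≤ level n} => t.1 n) = v := funext fun n => by
    rw [htu n n.2, dif_pos n.2]
  have hx : (fun n : {n : Lat d // level n = 0} => t.2.1 n) = ξ := funext fun n => by
    rw [htx n n.2, dif_pos n.2]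
  have hy : (fun n : {n : Lat d // level n < 0} => t.2.2 n) = η := funext fun n => by
    rw [hty n n.2, dif_pos n.2]
  have hfin : energy 0 t ≠ ∞ := by
    simp only [energy, ENNReal.add_ne_top]
    refine ⟨⟨(memlp_iff _).1 ?_, (memlp_iff _).1 ?_⟩, (memlp_iff _).1 ?_⟩
    · rw [hu]; exact lp.memℓp v
    · rw [hx]; exact lp.memℓp ξ
    · rw [hy]; exact lp.memℓp η
  refine ⟨⟨t, ht, hfin⟩, ?_⟩
  refine WithLp.ofLp_injective 2 (Prod.ext (Subtype.ext hu) ?_)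
  exact WithLp.ofLp_injective 2 (Prod.ext (Subtype.ext hx) (Subtype.ext hy))

/-- `Γ` as a unitary operator. -/
def GammaEquiv : c.Traj ≃ₗᵢ[ℂ] BoundaryData d H E Es where
  toLinearEquiv := LinearEquiv.ofBijective c.Gamma ⟨c.Gamma_injective, c.Gamma_surjective⟩
  norm_map' _ := rfl

instance : CompleteSpace c.Traj :=
  (completeSpace_congr (e := c.GammaEquiv.toEquiv)
    c.GammaEquiv.isometry.isUniformEmbedding).2 inferInstance

/-- The norm of `𝓣` may be computed on any balanced sublattice `Ω_s`. -/
theorem enorm_sq_eq_energy (s : ℤ) (t : c.Traj) : ‖t‖ₑ ^ 2 = energy s (Traj.signal c t) := by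
  rw [c.energy_eq (t := Traj.signal c t) t.2.1 s 0, ← c.enorm_Gamma]
  rfl

/-! ### The shifts -/

/-- The shift `(u, x, y) ↦ (u(· - m), x(· - m), y(· - m))` of triples. -/
def shiftSignal (m : Lat d) : Signal d H E Es →ₗ[ℂ] Signal d H E Es where
  toFun t := (fun n => t.1 (n - m), fun n => t.2.1 (n - m), fun n => t.2.2 (n - m))
  map_add' _ _ := rfl
  map_smul' _ _ := rfl

theorem shiftSignal_mem (m : Lat d) {t : Signal d H E Es} (ht : t ∈ c.trajectories) :
    shiftSignal m t ∈ c.trajectories := by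
  intro n
  have h := ht (n - m)
  refine ⟨fun k => ?_, h.2⟩
  have := h.1 k
  rw [show n - m + unitVec k = n + unitVec k - m by abel] at this
  exact this

theorem energy_shiftSignal (m : Lat d) (s : ℤ) (t : Signal d H E Es) :
    energy s (shiftSignal m t) = energy (s - level m) t := by
  unfold energy shiftSignal
  congr 1
  · congr 1
    · exact ((Equiv.subRight m).subtypeEquiv fun n => by
        simp [level_sub]).tsum_eq
          (fun n : {n : Lat d // s - level m ≤ level n} => ‖t.1 n‖ₑ ^ 2)
    · exact ((Equiv.subRight m).subtypeEquiv fun n => by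
        simp [level_sub]).tsum_eq
          (fun n : {n : Lat d // level n = s - level m} => ‖t.2.1 n‖ₑ ^ 2)
  · exact ((Equiv.subRight m).subtypeEquiv fun n => by
      simp [level_sub]).tsum_eq
        (fun n : {n : Lat d // level n < s - level m} => ‖t.2.2 n‖ₑ ^ 2)

theorem shiftSignal_admissible (m : Lat d) {t : Signal d H E Es} (ht : t ∈ c.admissible) :
    shiftSignal m t ∈ c.admissible :=
  ⟨c.shiftSignal_mem m ht.1, by rw [energy_shiftSignal, c.energy_eq ht.1 _ 0]; exact ht.2⟩

/-- The shift on `𝓣` as a linear map. -/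
def shiftL (m : Lat d) : c.Traj →ₗ[ℂ] c.Traj :=
  (shiftSignal m).restrict (p := c.admissible) (q := c.admissible)
    fun _ ht => c.shiftSignal_admissible m ht

theorem shiftL_shiftL (m n : Lat d) (t : c.Traj) : c.shiftL m (c.shiftL n t) =
    c.shiftL (m + n) t := by
  have h : ∀ l : Lat d, l - m - n = l - (m + n) := fun l => by abel
  exact Subtype.ext (Prod.ext (funext fun l => congrArg t.u (h l))
    (Prod.ext (funext fun l => congrArg t.x (h l)) (funext fun l => congrArg t.y (h l))))

theorem shiftL_zero (t : c.Traj) : c.shiftL 0 t = t :=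
  Subtype.ext (Prod.ext (funext fun l => congrArg t.u (sub_zero l))
    (Prod.ext (funext fun l => congrArg t.x (sub_zero l))
      (funext fun l => congrArg t.y (sub_zero l))))

/-- The unitary shift `𝓤^m = 𝓤₁^{m₁} ⋯ 𝓤_d^{m_d}` on `𝓣`,
`(u, x, y) ↦ (u(· - m), x(· - m), y(· - m))`. -/
def shift (m : Lat d) : c.Traj ≃ₗᵢ[ℂ] c.Traj where
  toLinearEquiv := LinearEquiv.ofLinearMap (c.shiftL m) (c.shiftL (-m))
    (LinearMap.ext fun t => by
      simp only [LinearMap.comp_apply, shiftL_shiftL, add_neg_cancel, shiftL_zero,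
        LinearMap.id_apply])
    (LinearMap.ext fun t => by
      simp only [LinearMap.comp_apply, shiftL_shiftL, neg_add_cancel, shiftL_zero,
        LinearMap.id_apply])
  norm_map' t := by
    have h : ‖c.shiftL m t‖ₑ ^ 2 = ‖t‖ₑ ^ 2 := by
      rw [c.enorm_sq_eq_energy (level m), c.enorm_sq_eq_energy 0]
      refine (energy_shiftSignal m (level m) (Traj.signal c t)).trans ?_
      rw [sub_self]
    have h' := (ENNReal.pow_right_strictMono two_ne_zero).injective h
    exact enorm_eq_iff_norm_eq.1 h'

/-- The shift `𝓤_k`. -/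
abbrev Ucal (k : Fin d) : c.Traj ≃ₗᵢ[ℂ] c.Traj := c.shift (unitVec k)

/-! ### Subspaces of `𝓣` and the de Branges--Rovnyak map -/

/-- The de Branges--Rovnyak map `Π_dBR : (u, x, y) ↦ (ŷ, û)`, where `û`, `ŷ` are the formal
Laurent series `∑ u(n) zⁿ`, `∑ y(n) zⁿ`. -/
def dBR : c.Traj →ₗ[ℂ] (Lat d → WithLp 2 (Es × E)) where
  toFun t n := WithLp.toLp 2 (t.y n, t.u n)
  map_add' _ _ := rfl
  map_smul' _ _ := rfl

/-- The incoming scattering space: trajectories whose data on `Ω_0` vanish except for `u(0)`. -/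
def scatIn : Submodule ℂ c.Traj where
  carrier := {t | (∀ n, 0 ≤ level n → n ≠ 0 → t.u n = 0) ∧ (∀ n, level n = 0 → t.x n = 0) ∧
    ∀ n, level n < 0 → t.y n = 0}
  zero_mem' := ⟨fun _ _ _ => rfl, fun _ _ => rfl, fun _ _ => rfl⟩
  add_mem' {s t} hs ht := by
    refine ⟨fun n h h' => ?_, fun n h => ?_, fun n h => ?_⟩
    · exact (congrArg₂ (· + ·) (hs.1 n h h') (ht.1 n h h')).trans (add_zero 0)
    · exact (congrArg₂ (· + ·) (hs.2.1 n h) (ht.2.1 n h)).trans (add_zero 0)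
    · exact (congrArg₂ (· + ·) (hs.2.2 n h) (ht.2.2 n h)).trans (add_zero 0)
  smul_mem' a t ht := by
    refine ⟨fun n h h' => ?_, fun n h => ?_, fun n h => ?_⟩
    · exact (congrArg (a • ·) (ht.1 n h h')).trans (smul_zero a)
    · exact (congrArg (a • ·) (ht.2.1 n h)).trans (smul_zero a)
    · exact (congrArg (a • ·) (ht.2.2 n h)).trans (smul_zero a)

/-- The outgoing scattering space: trajectories whose data on `Ω_1` vanish except for `y(0)`. -/
def scatOut : Submodule ℂ c.Traj where
  carrier := {t | (∀ n, 1 ≤ level n → t.u n = 0) ∧ (∀ n, level n = 1 → t.x n = 0) ∧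
    ∀ n, level n < 1 → n ≠ 0 → t.y n = 0}
  zero_mem' := ⟨fun _ _ => rfl, fun _ _ => rfl, fun _ _ _ => rfl⟩
  add_mem' {s t} hs ht := by
    refine ⟨fun n h => ?_, fun n h => ?_, fun n h h' => ?_⟩
    · exact (congrArg₂ (· + ·) (hs.1 n h) (ht.1 n h)).trans (add_zero 0)
    · exact (congrArg₂ (· + ·) (hs.2.1 n h) (ht.2.1 n h)).trans (add_zero 0)
    · exact (congrArg₂ (· + ·) (hs.2.2 n h h') (ht.2.2 n h h')).trans (add_zero 0)
  smul_mem' a t ht := by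
    refine ⟨fun n h => ?_, fun n h => ?_, fun n h h' => ?_⟩
    · exact (congrArg (a • ·) (ht.1 n h)).trans (smul_zero a)
    · exact (congrArg (a • ·) (ht.2.1 n h)).trans (smul_zero a)
    · exact (congrArg (a • ·) (ht.2.2 n h h')).trans (smul_zero a)

/-- `𝓚_scat-min`: the smallest closed subspace of `𝓣` which contains both scattering spaces and
reduces all the shifts. -/
def scatMin : Submodule ℂ c.Traj :=
  (⨆ n : Lat d, c.scatIn.map (c.shift n).toLinearEquiv.toLinearMap ⊔
    c.scatOut.map (c.shift n).toLinearEquiv.toLinearMap).topologicalClosure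

theorem level_zero : level (0 : Lat d) = 0 := by simp [level]

/-- The element of `ℓ²(Ω, E) ⊕ ℓ²(∂Ω, H) ⊕ ℓ²(ℤᵈ∖Ω, E_*)` whose only nonzero entry is `x(0) = h`. -/
def stateData : H →ₗ[ℂ] BoundaryData d H E Es where
  toFun h := WithLp.toLp 2 (0, WithLp.toLp 2
    (lp.single 2 (⟨0, level_zero⟩ : {n : Lat d // level n = 0}) h, 0))
  map_add' g h := by
    rw [← WithLp.toLp_add, Prod.mk_add_mk, ← WithLp.toLp_add, Prod.mk_add_mk,
      add_zero, add_zero, lp.single_add]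
  map_smul' a h := by
    rw [RingHom.id_apply, ← WithLp.toLp_smul, Prod.smul_mk, ← WithLp.toLp_smul,
      Prod.smul_mk, smul_zero, smul_zero, lp.single_smul]

/-- The isometric embedding `i_𝓗 : 𝓗 → 𝓣`: `i_𝓗 h` is the trajectory with `x(0) = h` and all the
other data on `Ω_0` (that is `u(n)` for `|n| ≥ 0`, `x(n)` for `|n| = 0`, `n ≠ 0`, and `y(n)` for
`|n| < 0`) equal to zero. -/
def iH : H →ₗ[ℂ] c.Traj := c.GammaEquiv.symm.toLinearEquiv.toLinearMap ∘ₗ stateData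

theorem Gamma_iH (h : H) : c.Gamma (c.iH h) = stateData h :=
  c.GammaEquiv.apply_symm_apply (stateData h)

theorem iH_u (h : H) (n : Lat d) (hn : 0 ≤ level n) : (c.iH h).u n = 0 :=
  congrFun (congrArg Subtype.val (congrArg WithLp.fst (c.Gamma_iH h))) ⟨n, hn⟩

theorem iH_y (h : H) (n : Lat d) (hn : level n < 0) : (c.iH h).y n = 0 :=
  congrFun (congrArg Subtype.val (congrArg WithLp.snd (congrArg WithLp.snd (c.Gamma_iH h)))) ⟨n, hn⟩

theorem iH_x (h : H) (n : Lat d) (hn : level n = 0) :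
    (c.iH h).x n = if n = 0 then h else 0 := by
  have h1 := congrFun (congrArg Subtype.val (congrArg WithLp.fst
    (congrArg WithLp.snd (c.Gamma_iH h)))) ⟨n, hn⟩
  refine h1.trans ?_
  split_ifs with h0
  · subst h0
    exact lp.single_apply_self (E := fun _ : {n : Lat d // level n = 0} => H) 2 _ h
  · exact lp.single_apply_ne (E := fun _ : {n : Lat d // level n = 0} => H) 2 _ h
      fun h' => h0 (congrArg Subtype.val h')

theorem norm_iH (h : H) : ‖c.iH h‖ = ‖h‖ := by
  have h1 : ‖c.iH h‖ₑ ^ 2 = ‖h‖ₑ ^ 2 := by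
    change ‖c.Gamma (c.iH h)‖ₑ ^ 2 = _
    rw [c.Gamma_iH]
    refine (enorm_sq_prod _ _).trans ?_
    rw [enorm_sq_prod, ← ofReal_norm (lp.single _ _ _), lp.norm_single two_pos]
    simp
  exact enorm_eq_iff_norm_eq.1 ((ENNReal.pow_right_strictMono two_ne_zero).injective h1)

/-- The shifted embedding `i'_𝓗 : 𝓗 → 𝓣`, `h ↦ ∑ 𝓤_k i_𝓗 (P_k h)`, which is an isometry of `𝓗` onto
`𝓛'`. -/
def iH' : H →ₗ[ℂ] c.Traj :=
  ∑ k, (c.Ucal k).toLinearEquiv.toLinearMap ∘ₗ c.iH ∘ₗ (c.P k).toLinearMap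

/-- `𝓛_k`: the trajectories whose data on `Ω_0` vanish except for the component `P_k x(0)`. -/
def Lk (k : Fin d) : Submodule ℂ c.Traj where
  carrier := {t | (∀ n, 0 ≤ level n → t.u n = 0) ∧
    (∀ j n, level n = 0 → (j ≠ k ∨ n ≠ 0) → c.P j (t.x n) = 0) ∧ ∀ n, level n < 0 → t.y n = 0}
  zero_mem' := ⟨fun _ _ => rfl, fun _ _ _ _ => map_zero _, fun _ _ => rfl⟩
  add_mem' {s t} hs ht := by
    refine ⟨fun n h => ?_, fun j n h h' => ?_, fun n h => ?_⟩
    · exact (congrArg₂ (· + ·) (hs.1 n h) (ht.1 n h)).trans (add_zero 0)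
    · refine (map_add (c.P j) (s.x n) (t.x n)).trans ?_
      rw [hs.2.1 j n h h', ht.2.1 j n h h', add_zero]
    · exact (congrArg₂ (· + ·) (hs.2.2 n h) (ht.2.2 n h)).trans (add_zero 0)
  smul_mem' a t ht := by
    refine ⟨fun n h => ?_, fun j n h h' => ?_, fun n h => ?_⟩
    · exact (congrArg (a • ·) (ht.1 n h)).trans (smul_zero a)
    · refine (map_smul (c.P j) a (t.x n)).trans ?_
      rw [ht.2.1 j n h h', smul_zero]
    · exact (congrArg (a • ·) (ht.2.2 n h)).trans (smul_zero a)

theorem Lk_eq_map (k : Fin d) : c.Lk k = (LinearMap.range (c.P k).toLinearMap).map c.iH := by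
  ext t
  constructor
  · rintro ⟨hu, hx, hy⟩
    refine ⟨c.P k (t.x 0), ⟨t.x 0, rfl⟩, c.Gamma_injective ?_⟩
    have h0 : c.P k (t.x 0) = t.x 0 := by
      conv_rhs => rw [← c.sum_P_apply (t.x 0)]
      exact (Finset.sum_eq_single k (fun j _ hj => hx j 0 level_zero (Or.inl hj))
        (fun h => absurd (Finset.mem_univ k) h)).symm
    refine WithLp.ofLp_injective 2 (Prod.ext (Subtype.ext (funext fun n => ?_)) ?_)
    · exact (c.iH_u _ n n.2).trans (hu n n.2).symm
    refine WithLp.ofLp_injective 2 (Prod.ext (Subtype.ext (funext fun n => ?_))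
      (Subtype.ext (funext fun n => ?_)))
    · refine (c.iH_x _ n n.2).trans ?_
      change _ = t.x n
      split_ifs with hn
      · rw [h0, hn]
      · rw [← c.sum_P_apply (t.x n)]
        exact (Finset.sum_eq_zero fun j _ => hx j n n.2 (Or.inr hn)).symm
    · exact (c.iH_y _ n n.2).trans (hy n n.2).symm
  · rintro ⟨_, ⟨h, rfl⟩, rfl⟩
    refine ⟨c.iH_u _, fun j n hn hj => ?_, c.iH_y _⟩
    rw [c.iH_x _ n hn]
    split_ifs with h0
    · exact (c.P_P_apply j k h).trans (if_neg (hj.resolve_right fun h' => h' h0))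
    · exact map_zero _

instance (k : Fin d) : CompleteSpace (c.Lk k) := by
  have hc : IsComplete ((LinearMap.range (c.P k).toLinearMap : Submodule ℂ H) : Set H) := by
    have := (c.isStarProjection k).isIdempotentElem
    exact (ContinuousLinearMap.IsIdempotentElem.isClosed_range this).isComplete
  let e : H →ₗᵢ[ℂ] c.Traj := ⟨c.iH, c.norm_iH⟩
  have h := (isComplete_image_iff e.isometry.isUniformInducing).2 hc
  rw [c.Lk_eq_map]
  exact h.completeSpace_coe

/-- `𝓛 = 𝓛₁ ⊕ ⋯ ⊕ 𝓛_d`. -/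
def L : Submodule ℂ c.Traj := ⨆ k, c.Lk k

/-- `𝓤_k 𝓛_k`. -/
def Lk' (k : Fin d) : Submodule ℂ c.Traj := (c.Lk k).map (c.Ucal k).toLinearEquiv.toLinearMap

instance (k : Fin d) : CompleteSpace (c.Lk' k) := by
  have h1 : CompleteSpace (c.Lk k) := inferInstance
  have hc : IsComplete ((c.Lk k : Submodule ℂ c.Traj) : Set c.Traj) :=
    completeSpace_coe_iff_isComplete.1 h1
  exact ((isComplete_image_iff
    (c.Ucal k).isometry.isUniformInducing).2 hc).completeSpace_coe

/-- `𝓛' = 𝓤₁ 𝓛₁ ⊕ ⋯ ⊕ 𝓤_d 𝓛_d`. -/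
def L' : Submodule ℂ c.Traj := ⨆ k, c.Lk' k

/-- `𝓛_scc = i_𝓗 (𝓗_scc)`. -/
def Lscc : Submodule ℂ c.Traj := c.Hscc.map c.iH

/-- `𝓛_sscc = i'_𝓗 (𝓗_sscc)`. -/
def Lsscc : Submodule ℂ c.Traj := c.Hsscc.map c.iH'

/-- `Π_dBR` maps the subspace `M` of `𝓣` unitarily onto `𝓗(K)`. -/
def IsUnitaryOnto (M : Submodule ℂ c.Traj) (K : PosKernel d (WithLp 2 (Es × E))) : Prop :=
  ∃ Φ : M ≃ₗᵢ[ℂ] FRKHS K, ∀ t : M, ⇑(Φ t) = c.dBR t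

end Colligation

/-- `M ⊖ N`, the orthogonal complement of `N` in `M`. -/
def ominus {X : Type*} [NormedAddCommGroup X] [InnerProductSpace ℂ X] (M N : Submodule ℂ X) :
    Submodule ℂ X := M ⊓ Nᗮ

/-- The subspace `M` is invariant under each of the orthogonal projections onto the `N_k`. -/
def InvariantUnder {ι X : Type*} [NormedAddCommGroup X] [InnerProductSpace ℂ X]
    (M : Submodule ℂ X) (N : ι → Submodule ℂ X) [∀ k, (N k).HasOrthogonalProjection] : Prop :=
  ∀ k, ∀ t ∈ M, (N k).starProjection t ∈ M

end

end GivoneRoesser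

/-! Everything happens in the state space $\mathcal H$. A family of operators $T_n$ from $\mathcal
H$ to $\mathcal E_*\oplus\mathcal E$ gives a map $h\mapsto\sum (T_nh)z^n$. If $K_{n,m}=T_nT_m^*$,
this map is a coisometry of $\mathcal H$ onto $\mathcal H(K)$ with kernel $\bigcap_n\ker T_n$
(`exists_isometryEquiv_FRKHS`).

Solving the system forwards and backwards from the single datum $x(0)=h$ shows that $\Pi_{dBR}$
composed with $i_{\mathcal H}$ is this map for $T=$ `obs` (`dBR_iH`). For $i'_{\mathcal H}$ it is
the map for $T=$ `obs'` (`dBR_iH'`). In both cases the kernels $K_k$ (resp. $K'_k$) come from the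
family $T_nP_k$, and since $\sum_k P_k=I$ their sum comes from $T_n$.

Evaluations of $u$ and $y$ are inner products with shifted scattering vectors, so the orthogonal
complement of $\mathcal K_{\text{scat-min}}$ is $\ker\Pi_{dBR}$ (`mem_scatMin_orthogonal`). Put
$N=\bigcap_n\ker T_n$. Then $\mathcal L\cap\mathcal K_{\text{scat-min}}^\perp$ is the copy of $N$ in
$\mathcal T$ and $\mathcal L_{scc}$ is the copy of $N^\perp$ (`Hscc_eq`); the primed spaces behave
alike. This gives the unitarity statements.

An element of the overlapping space consists of series $f_k=\sum_n (T_nP_kh_k)z^n$. These sum to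
zero iff $\sum_kP_kh_k\in N$, and $f_k=0$ iff $P_kh_k\in N$. So the space is zero iff $N$ is
invariant under every $P_k$, equivalently iff $N^\perp$ is, because the $P_k$ are self-adjoint. The
isometries carry $P_k$ to the projections onto $\mathcal L_k$ and $\mathcal U_k\mathcal L_k$. -/

namespace GivoneRoesser

noncomputable section

/-! ### Reproducing kernel spaces of factored kernels. -/

section Kernels

variable {d : ℕ} {F X : Type*} [NormedAddCommGroup F] [InnerProductSpace ℂ F]
  [NormedAddCommGroup X] [InnerProductSpace ℂ X]

/-- The common kernel of a family of bounded operators. -/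
def commonKer {ι : Type*} (T : ι → X →L[ℂ] F) : Submodule ℂ X := ⨅ n, LinearMap.ker (T n).toLinearMap

theorem mem_commonKer {ι : Type*} {T : ι → X →L[ℂ] F} {x : X} :
    x ∈ commonKer T ↔ ∀ n, T n x = 0 := by
  simp [commonKer]

theorem isClosed_commonKer {ι : Type*} (T : ι → X →L[ℂ] F) :
    IsClosed (commonKer T : Set X) := by
  rw [commonKer, Submodule.coe_iInf]
  exact isClosed_iInter fun n => (T n).isClosed_ker

variable [CompleteSpace F] [CompleteSpace X]

instance {ι : Type*} (T : ι → X →L[ℂ] F) : CompleteSpace (commonKer T) :=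
  (isClosed_commonKer T).completeSpace_coe

theorem adjoint_mem_commonKer_orthogonal {ι : Type*} (T : ι → X →L[ℂ] F) (n : ι) (v : F) :
    (T n).adjoint v ∈ (commonKer T)ᗮ := by
  rw [Submodule.mem_orthogonal]
  intro x hx
  rw [ContinuousLinearMap.adjoint_inner_right, mem_commonKer.1 hx n, inner_zero_left]

/-- The map `∑ v_n ↦ ∑ T_n* v_n` on finitely supported families. -/
def adjointSum (T : Lat d → X →L[ℂ] F) : (Lat d →₀ F) →ₗ[ℂ] (commonKer T)ᗮ :=
  Finsupp.lsum ℂ fun n => (T n).adjoint.toLinearMap.codRestrict _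
    (adjoint_mem_commonKer_orthogonal T n)

theorem adjointSum_single (T : Lat d → X →L[ℂ] F) (n : Lat d) (v : F) :
    (adjointSum T (Finsupp.single n v) : X) = (T n).adjoint v := by
  simp [adjointSum]

/-- The map `∑ v_n ↦ ∑ K_{·,n} v_n` on finitely supported families. -/
def kernelSum (K : PosKernel d F) : (Lat d →₀ F) →ₗ[ℂ] FRKHS K :=
  Finsupp.lsum ℂ fun n => (RKHS.kerFun (FRKHS K) n).toLinearMap

theorem kernelSum_single (K : PosKernel d F) (n : Lat d) (v : F) :
    kernelSum K (Finsupp.single n v) = RKHS.kerFun (FRKHS K) n v := by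
  simp [kernelSum]

theorem denseRange_of_orthogonal {Y Z : Type*} [AddCommGroup Y] [Module ℂ Y]
    [NormedAddCommGroup Z] [InnerProductSpace ℂ Z] [CompleteSpace Z] (f : Y →ₗ[ℂ] Z)
    (h : ∀ z, (∀ y, ⟪f y, z⟫_ℂ = 0) → z = 0) : DenseRange f := by
  have h1 : (LinearMap.range f)ᗮ = ⊥ := by
    rw [Submodule.eq_bot_iff]
    intro z hz
    exact h z fun y => (Submodule.mem_orthogonal _ _).1 hz _ ⟨y, rfl⟩
  have h2 := Submodule.dense_iff_topologicalClosure_eq_top.2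
    (Submodule.topologicalClosure_eq_top_iff.2 h1)
  rwa [LinearMap.coe_range] at h2

/-- A vector orthogonal to every $T_n^*v$ lies in the common kernel, so inside its orthogonal
complement only zero remains. -/
theorem denseRange_adjointSum (T : Lat d → X →L[ℂ] F) : DenseRange (adjointSum T) := by
  refine denseRange_of_orthogonal _ fun z hz => ?_
  have h1 : (z : X) ∈ commonKer T := mem_commonKer.2 fun n => ext_inner_left ℂ fun v => by
    have := hz (Finsupp.single n v)
    rw [Submodule.coe_inner, adjointSum_single, ContinuousLinearMap.adjoint_inner_left] at this
    rw [this, inner_zero_right]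
  have h2 := (Submodule.mem_orthogonal _ _).1 z.2 _ h1
  exact Subtype.ext (inner_self_eq_zero.1 h2)

theorem denseRange_kernelSum (K : PosKernel d F) : DenseRange (kernelSum K) := by
  refine denseRange_of_orthogonal _ fun z hz => RKHS.ext fun n => ext_inner_left ℂ fun v => ?_
  have := hz (Finsupp.single n v)
  rw [kernelSum_single, RKHS.kerFun_inner] at this
  rw [this, RKHS.coe_zero, Pi.zero_apply, inner_zero_right]

/-- On single-term families both sides are $\langle v,K_{n,m}w\rangle=\langle T_n^*v,T_m^*w\rangle$.
This makes the correspondence $T_n^*v\leftrightarrow K_{\cdot,n}v$ isometric. -/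
theorem inner_kernelSum (T : Lat d → X →L[ℂ] F) (K : PosKernel d F)
    (hK : ∀ n m, K.coeff n m = T n ∘L (T m).adjoint) (f g : Lat d →₀ F) :
    ⟪kernelSum K f, kernelSum K g⟫_ℂ = ⟪adjointSum T f, adjointSum T g⟫_ℂ := by
  induction f using Finsupp.induction_linear with
  | zero => simp
  | add f₁ f₂ h₁ h₂ => simp only [map_add, inner_add_left, h₁, h₂]
  | single n v =>
    induction g using Finsupp.induction_linear with
    | zero => simp
    | add g₁ g₂ h₁ h₂ => simp only [map_add, inner_add_right, h₁, h₂]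
    | single m w =>
      rw [Submodule.coe_inner, adjointSum_single, adjointSum_single, kernelSum_single,
        kernelSum_single, RKHS.kerFun_inner, RKHS.kerFun_apply, kernel_FRKHS, hK,
        ContinuousLinearMap.adjoint_inner_left]
      rfl

/-- If `K_{n,m} = T_n T_m*`, then `x ↦ ∑ (T_n x) zⁿ` maps `(⋂ ker T_n)ᗮ` unitarily onto `𝓗(K)`. -/
theorem exists_isometryEquiv_FRKHS (T : Lat d → X →L[ℂ] F) (K : PosKernel d F)
    (hK : ∀ n m, K.coeff n m = T n ∘L (T m).adjoint) :
    ∃ Φ : (commonKer T)ᗮ ≃ₗᵢ[ℂ] FRKHS K, ∀ x n, Φ x n = T n x := by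
  have hnorm : ∀ f, ‖kernelSum K (LinearEquiv.refl ℂ _ f)‖ = ‖adjointSum T f‖ := fun f => by
    rw [LinearEquiv.refl_apply, norm_eq_sqrt_re_inner (𝕜 := ℂ), norm_eq_sqrt_re_inner (𝕜 := ℂ),
      inner_kernelSum T K hK]
  -- The unitary is the continuous extension of $T_n^*v\mapsto K_{\cdot,n}v$; equality of norms
  -- makes it well defined, and both ranges are dense.
  refine ⟨(LinearEquiv.refl ℂ (Lat d →₀ F)).extendOfIsometry (adjointSum T) (kernelSum K)
    (denseRange_adjointSum T) (denseRange_kernelSum K) hnorm, fun x n => ?_⟩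
  set Φ := (LinearEquiv.refl ℂ (Lat d →₀ F)).extendOfIsometry (adjointSum T) (kernelSum K)
    (denseRange_adjointSum T) (denseRange_kernelSum K) hnorm with hΦ
  have h1 : ∀ f, Φ (adjointSum T f) = kernelSum K f := fun f =>
    LinearEquiv.extendOfIsometry_eq _ _ _ _ _ hnorm f
  refine ext_inner_left ℂ fun v => ?_
  -- Reproducing property: $\langle v,(\Phi x)_n\rangle=\langle\Phi(T_n^*v),\Phi x\rangle=\langle
  -- T_n^*v,x\rangle$.
  rw [← RKHS.kerFun_inner, ← kernelSum_single, ← h1, LinearIsometryEquiv.inner_map_map,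
    Submodule.coe_inner, adjointSum_single, ContinuousLinearMap.adjoint_inner_left]

/-- If `K_{n,m} = T_n T_m*`, then every series `∑ (T_n x) zⁿ` belongs to `𝓗(K)`. -/
theorem exists_FRKHS_eq (T : Lat d → X →L[ℂ] F) (K : PosKernel d F)
    (hK : ∀ n m, K.coeff n m = T n ∘L (T m).adjoint) (x : X) :
    ∃ f : FRKHS K, ∀ n, f n = T n x := by
  obtain ⟨Φ, hΦ⟩ := exists_isometryEquiv_FRKHS T K hK
  -- Removing the component of $x$ in the common kernel changes no coefficient $T_nx$.
  have hx := (commonKer T).sub_starProjection_mem_orthogonal x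
  refine ⟨Φ ⟨_, hx⟩, fun n => ?_⟩
  rw [hΦ]
  change T n (x - _) = _
  rw [map_sub, mem_commonKer.1 ((commonKer T).starProjection_apply_mem x) n, sub_zero]

/-- If `K_{n,m} = T_n T_m*`, then every element of `𝓗(K)` is of the form `∑ (T_n x) zⁿ`. -/
theorem FRKHS.exists_eq (T : Lat d → X →L[ℂ] F) (K : PosKernel d F)
    (hK : ∀ n m, K.coeff n m = T n ∘L (T m).adjoint) (f : FRKHS K) :
    ∃ x : X, ∀ n, f n = T n x := by
  obtain ⟨Φ, hΦ⟩ := exists_isometryEquiv_FRKHS T K hK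
  exact ⟨Φ.symm f, fun n => by rw [← hΦ, Φ.apply_symm_apply]⟩

end Kernels

namespace Colligation

variable {d : ℕ} {H E Es : Type*}
  [NormedAddCommGroup H] [InnerProductSpace ℂ H] [CompleteSpace H]
  [NormedAddCommGroup E] [InnerProductSpace ℂ E] [CompleteSpace E]
  [NormedAddCommGroup Es] [InnerProductSpace ℂ Es] [CompleteSpace Es]
  (c : Colligation d H E Es)

/-! ### Words, and recursions for the coefficients of the resolvent. -/

theorem abelianize_nil : abelianize ([] : List (Fin d)) = 0 := by
  funext k; simp [abelianize]

theorem abelianize_append (v w : List (Fin d)) :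
    abelianize (v ++ w) = abelianize v + abelianize w := by
  funext k; simp [abelianize, List.count_append]

theorem abelianize_singleton (k : Fin d) : abelianize [k] = unitVec k := by
  funext j
  by_cases h : j = k
  · subst h; simp [abelianize, unitVec]
  · simp [abelianize, unitVec, h, Ne.symm h]

theorem abelianize_cons (k : Fin d) (w : List (Fin d)) :
    abelianize (k :: w) = abelianize w + unitVec k := by
  rw [← List.singleton_append, abelianize_append, abelianize_singleton, add_comm]

theorem level_abelianize (w : List (Fin d)) : level (abelianize w) = w.length := by
  induction w with
  | nil => rw [abelianize_nil, level_zero]; simp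
  | cons k w ih => rw [abelianize_cons, level_add, level_unitVec, ih]; simp

/-- Such words all have length $|n|$. Finiteness lets the `finsum` in `abPow` be split and
multiplied term by term. -/
theorem finite_abelianize_eq (n : Lat d) : {w : List (Fin d) | abelianize w = n}.Finite := by
  refine (List.finite_length_eq (Fin d) (level n).toNat).subset fun w hw => ?_
  have := level_abelianize w
  rw [show abelianize w = n from hw] at this
  simp [this]

theorem abPow_of_level_neg (X : H →L[ℂ] H) {n : Lat d} (hn : level n < 0) : c.abPow X n = 0 := by
  refine finsum_mem_eq_zero_of_forall_eq_zero fun w hw => ?_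
  have := level_abelianize w
  rw [show abelianize w = n from hw] at this
  omega

theorem abPow_zero (X : H →L[ℂ] H) : c.abPow X 0 = 1 := by
  have h : {w : List (Fin d) | abelianize w = 0} = {[]} := by
    ext w
    simp only [Set.mem_ofPred_eq, Set.mem_singleton_iff]
    constructor
    · intro hw
      have := level_abelianize w
      rw [hw, level_zero] at this
      exact List.eq_nil_of_length_eq_zero (by omega)
    · rintro rfl; exact abelianize_nil
  rw [abPow, h, finsum_mem_singleton]
  simp

/-- Split off the head of the list, which is the factor applied last. For $R=(I-Z(z)X)^{-1}$ this is
$R=I+Z(z)XR$ away from the constant term; the empty word occurs only for $n=0$. -/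
theorem abPow_eq_of_ne_zero (X : H →L[ℂ] H) {n : Lat d} (hn : n ≠ 0) :
    c.abPow X n = ∑ k, (c.P k * X) * c.abPow X (n - unitVec k) := by
  have h : {w : List (Fin d) | abelianize w = n} =
      ⋃ k, (List.cons k) '' {w : List (Fin d) | abelianize w = n - unitVec k} := by
    ext w
    simp only [Set.mem_ofPred_eq, Set.mem_iUnion, Set.mem_image]
    constructor
    · intro hw
      cases w with
      | nil => exact absurd (hw.symm.trans abelianize_nil) hn
      | cons k w => exact ⟨k, w, by rw [← hw, abelianize_cons, add_sub_cancel_right], rfl⟩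
    · rintro ⟨k, w, hw, rfl⟩
      rw [abelianize_cons, hw, sub_add_cancel]
  rw [abPow, h, finsum_mem_iUnion, finsum_eq_sum_of_fintype]
  · refine Finset.sum_congr rfl fun k _ => ?_
    rw [finsum_mem_image (List.cons_injective.injOn), abPow]
    exact ((AddMonoidHom.mulLeft (c.P k * X)).map_finsum_mem _ (finite_abelianize_eq _)).symm
  · intro j k hjk
    rw [Function.onFun, Set.disjoint_left]
    rintro _ ⟨v, _, rfl⟩ ⟨w, _, h⟩
    exact hjk (List.cons.inj h).1.symm
  · exact fun k => (finite_abelianize_eq _).image _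

/-- The other resolvent identity $R=I+RZ(z)X$: here the end of the list, the factor applied first,
is split off. -/
theorem abPow_eq_of_ne_zero' (X : H →L[ℂ] H) {n : Lat d} (hn : n ≠ 0) :
    c.abPow X n = ∑ k, c.abPow X (n - unitVec k) * (c.P k * X) := by
  have h : {w : List (Fin d) | abelianize w = n} =
      ⋃ k, (fun w => w ++ [k]) '' {w : List (Fin d) | abelianize w = n - unitVec k} := by
    ext w
    simp only [Set.mem_ofPred_eq, Set.mem_iUnion, Set.mem_image]
    constructor
    · intro hw
      cases w using List.reverseRecOn with
      | nil => exact absurd (hw.symm.trans abelianize_nil) hn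
      | append_singleton w k =>
        exact ⟨k, w, by rw [← hw, abelianize_append, abelianize_singleton, add_sub_cancel_right],
          rfl⟩
    · rintro ⟨k, w, hw, rfl⟩
      rw [abelianize_append, abelianize_singleton, hw, sub_add_cancel]
  rw [abPow, h, finsum_mem_iUnion, finsum_eq_sum_of_fintype]
  · refine Finset.sum_congr rfl fun k _ => ?_
    rw [finsum_mem_image ((List.append_left_injective [k]).injOn), abPow]
    refine Eq.trans ?_
      ((AddMonoidHom.mulRight (c.P k * X)).map_finsum_mem _ (finite_abelianize_eq _)).symm
    simp
  · intro j k hjk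
    rw [Function.onFun, Set.disjoint_left]
    rintro _ ⟨v, _, rfl⟩ ⟨w, _, h⟩
    exact hjk (List.cons.inj (List.append_inj' h rfl).2).1.symm
  · exact fun k => (finite_abelianize_eq _).image _

theorem level_sub_unitVec (n : Lat d) (k : Fin d) : level (n - unitVec k) = level n - 1 := by
  rw [level_sub, level_unitVec]

theorem level_add_unitVec (n : Lat d) (k : Fin d) : level (n + unitVec k) = level n + 1 := by
  rw [level_add, level_unitVec]

theorem level_neg (n : Lat d) : level (-n) = -level n := by
  simp [level]

theorem abPow_of_level_zero (X : H →L[ℂ] H) {n : Lat d} (hn : level n = 0) :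
    c.abPow X n = if n = 0 then 1 else 0 := by
  split_ifs with h
  · rw [h, abPow_zero]
  · rw [c.abPow_eq_of_ne_zero X h]
    refine Finset.sum_eq_zero fun k _ => ?_
    rw [c.abPow_of_level_neg X (by rw [level_sub_unitVec]; omega), mul_zero]

theorem abPow_eq (X : H →L[ℂ] H) (n : Lat d) :
    c.abPow X n = (if n = 0 then 1 else 0) + ∑ k, (c.P k * X) * c.abPow X (n - unitVec k) := by
  split_ifs with h
  · rw [Finset.sum_eq_zero, add_zero, h, abPow_zero]
    intro k _
    rw [c.abPow_of_level_neg X (by rw [level_sub_unitVec, h, level_zero]; omega), mul_zero]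
  · rw [zero_add, c.abPow_eq_of_ne_zero X h]

theorem abPow_eq' (X : H →L[ℂ] H) (n : Lat d) :
    c.abPow X n = (if n = 0 then 1 else 0) + ∑ k, c.abPow X (n - unitVec k) * (c.P k * X) := by
  split_ifs with h
  · rw [Finset.sum_eq_zero, add_zero, h, abPow_zero]
    intro k _
    rw [c.abPow_of_level_neg X (by rw [level_sub_unitVec, h, level_zero]; omega), zero_mul]
  · rw [zero_add, c.abPow_eq_of_ne_zero' X h]

/-- The coefficient of `zⁿ` in `(I - Z(z) X)⁻¹ Z(z)`. -/
def abPowMulZ (X : H →L[ℂ] H) (n : Lat d) : H →L[ℂ] H := ∑ k, c.abPow X (n - unitVec k) ∘L c.P k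

theorem abPowMulZ_of_level_nonpos (X : H →L[ℂ] H) {n : Lat d} (hn : level n ≤ 0) :
    c.abPowMulZ X n = 0 := by
  refine Finset.sum_eq_zero fun k _ => ?_
  rw [c.abPow_of_level_neg X (by rw [level_sub_unitVec]; omega), ContinuousLinearMap.zero_comp]

/-- With $M=RZ(z)$, multiplying $R=I+Z(z)XR$ on the right by $Z(z)$ gives $M=Z(z)+Z(z)XM$. -/
theorem abPowMulZ_eq (X : H →L[ℂ] H) (n : Lat d) : c.abPowMulZ X n =
    ∑ k, ((if n = unitVec k then c.P k else 0) + (c.P k * X) * c.abPowMulZ X (n - unitVec k)) := by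
  have h : ∀ k, c.abPow X (n - unitVec k) ∘L c.P k = (if n = unitVec k then c.P k else 0) +
      ∑ j, (c.P j * X) * (c.abPow X (n - unitVec j - unitVec k) ∘L c.P k) := fun k => by
    rw [c.abPow_eq X (n - unitVec k), ← ContinuousLinearMap.mul_def, add_mul, Finset.sum_mul]
    congr 1
    · simp [sub_eq_zero]
    · refine Finset.sum_congr rfl fun j _ => ?_
      rw [mul_assoc, ← ContinuousLinearMap.mul_def, sub_right_comm]
  simp only [abPowMulZ, h, Finset.sum_add_distrib, Finset.mul_sum]
  rw [Finset.sum_comm]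

theorem star_P (k : Fin d) : star (c.P k) = c.P k := (c.isStarProjection k).isSelfAdjoint

/-- Taking adjoints of coefficients in $RZ=Z+RZX^*Z$, which rests on the right-hand recursion for
$X^*$, gives the same recursion as `abPowMulZ_eq`. -/
theorem star_abPowMulZ_star_eq (X : H →L[ℂ] H) (n : Lat d) : star (c.abPowMulZ (star X) n) =
    ∑ k, ((if n = unitVec k then c.P k else 0) +
      (c.P k * X) * star (c.abPowMulZ (star X) (n - unitVec k))) := by
  have h : ∀ k, star (c.abPow (star X) (n - unitVec k) ∘L c.P k) =
      (if n = unitVec k then c.P k else 0) +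
      ∑ j, (c.P k * X) * star (c.abPow (star X) (n - unitVec k - unitVec j) ∘L c.P j) := fun k => by
    rw [c.abPow_eq' (star X) (n - unitVec k), ← ContinuousLinearMap.mul_def, star_mul, star_P,
      star_add, mul_add, star_sum, Finset.mul_sum]
    congr 1
    · split_ifs <;> simp_all [sub_eq_zero]
    · refine Finset.sum_congr rfl fun j _ => ?_
      simp only [← ContinuousLinearMap.mul_def, star_mul, star_star, star_P, mul_assoc]
  simp only [abPowMulZ, h, star_sum, Finset.sum_add_distrib, Finset.mul_sum]

/-- `Z (I - X Z)⁻¹ = (I - Z X)⁻¹ Z`. -/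
theorem star_abPowMulZ_star (X : H →L[ℂ] H) (n : Lat d) :
    star (c.abPowMulZ (star X) n) = c.abPowMulZ X n := by
  -- Both sides vanish for $|n|\le0$ and obey the same recursion, which lowers $|n|$ by one.
  have key : ∀ (s : ℕ) (n : Lat d), level n ≤ s →
      star (c.abPowMulZ (star X) n) = c.abPowMulZ X n := by
    intro s
    induction s with
    | zero =>
      intro n hn
      rw [c.abPowMulZ_of_level_nonpos _ (by simpa using hn),
        c.abPowMulZ_of_level_nonpos _ (by simpa using hn), star_zero]
    | succ s ih =>
      intro n hn
      rw [star_abPowMulZ_star_eq, abPowMulZ_eq]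
      refine Finset.sum_congr rfl fun k _ => ?_
      rw [ih _ (by rw [level_sub_unitVec]; push_cast at hn; omega)]
  exact key (level n).toNat n (Int.self_le_toNat _)

/-- Needed to recognize the generators of $\mathcal H_{scc}$ and $\mathcal H_{sscc}$ as adjoints of
the coefficients of `obs` and `obs'`. -/
theorem adjoint_abPowMulZ (X : H →L[ℂ] H) (n : Lat d) :
    (c.abPowMulZ X n).adjoint = c.abPowMulZ X.adjoint n := by
  have h := c.star_abPowMulZ_star X n
  rw [← h, ContinuousLinearMap.star_eq_adjoint, ContinuousLinearMap.adjoint_adjoint]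
  rfl

/-! ### System equations in both time directions, and the trajectories $i_{\mathcal H}h$. -/

theorem U_symm_apply (h : H) (y : Es) : c.U.symm (WithLp.toLp 2 (h, y)) =
    WithLp.toLp 2 (c.A.adjoint h + c.C.adjoint y, c.B.adjoint h + c.D.adjoint y) := by
  refine ext_inner_right ℂ fun v => ?_
  obtain ⟨⟨g, e⟩, rfl⟩ := WithLp.toLp_surjective 2 v
  rw [← LinearIsometryEquiv.inner_map_map c.U, LinearIsometryEquiv.apply_symm_apply, U_apply]
  simp only [WithLp.prod_inner_apply, inner_add_left, inner_add_right,
    ContinuousLinearMap.adjoint_inner_left]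
  ring

theorem Traj.system (t : c.Traj) (n : Lat d) :
    c.U (WithLp.toLp 2 (t.x n, t.u n)) = WithLp.toLp 2 (c.next t.x n, t.y n) :=
  (c.mem_trajectories_iff _).1 t.2.1 n

theorem Traj.y_eq (t : c.Traj) (n : Lat d) : t.y n = c.C (t.x n) + c.D (t.u n) := by
  have h := Traj.system c t n
  rw [U_apply] at h
  exact (congrArg WithLp.snd h).symm

theorem Traj.next_eq (t : c.Traj) (n : Lat d) : c.next t.x n = c.A (t.x n) + c.B (t.u n) := by
  have h := Traj.system c t n
  rw [U_apply] at h
  exact (congrArg WithLp.fst h).symm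

theorem Traj.x_eq (t : c.Traj) (n : Lat d) :
    t.x n = c.A.adjoint (c.next t.x n) + c.C.adjoint (t.y n) := by
  have h := Traj.system c t n
  rw [← LinearIsometryEquiv.eq_symm_apply, U_symm_apply] at h
  exact congrArg WithLp.fst h

theorem Traj.u_eq (t : c.Traj) (n : Lat d) :
    t.u n = c.B.adjoint (c.next t.x n) + c.D.adjoint (t.y n) := by
  have h := Traj.system c t n
  rw [← LinearIsometryEquiv.eq_symm_apply, U_symm_apply] at h
  exact congrArg WithLp.snd h

/-- With zero input the forward step is $P_kx(n)=P_kAx(n-e_k)$, the recursion of `abPow`; on level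
$0$ both sides are $h$ at the origin and $0$ elsewhere. -/
theorem iH_x_of_level_nonneg (h : H) (n : Lat d) (hn : 0 ≤ level n) :
    (c.iH h).x n = c.abPow c.A n h := by
  have key : ∀ (s : ℕ) n, level n = s → (c.iH h).x n = c.abPow c.A n h := by
    intro s
    induction s with
    | zero =>
      intro n hn
      rw [c.iH_x _ _ (by simpa using hn), c.abPow_of_level_zero _ (by simpa using hn)]
      split_ifs <;> rfl
    | succ s ih =>
      intro n hn
      have hn0 : n ≠ 0 := by
        rintro rfl
        rw [level_zero] at hn
        push_cast at hn
        omega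
      rw [← c.sum_P_next (c.iH h).x n, c.abPow_eq_of_ne_zero _ hn0, sum_apply]
      refine Finset.sum_congr rfl fun k _ => ?_
      have hl : level (n - unitVec k) = s := by
        rw [level_sub_unitVec, hn]; push_cast; ring
      rw [Traj.next_eq, c.iH_u _ _ (by omega), map_zero, add_zero, ih _ hl]
      rfl
  exact key (level n).toNat n (Int.toNat_of_nonneg hn).symm

/-- With zero output $x=A^*(\text{next }x)$, so `next` obeys the recursion of `abPowMulZ` in the
variable $-n$. It is followed instead of $x$ because $u=B^*(\text{next }x)$ there. -/
theorem iH_next_of_level_neg (h : H) (n : Lat d) (hn : level n < 0) :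
    c.next (c.iH h).x n = c.abPowMulZ c.A.adjoint (-n) h := by
  have key : ∀ (s : ℕ) n, level n = -((s + 1 : ℕ) : ℤ) →
      c.next (c.iH h).x n = c.abPowMulZ c.A.adjoint (-n) h := by
    intro s
    induction s with
    | zero =>
      intro n hn
      -- On level $-1$ only the term $Z(z)$ of the recursion contributes: it records the datum $h$
      -- at $n+e_k=0$.
      rw [c.abPowMulZ_eq, sum_apply]
      refine Finset.sum_congr rfl fun k _ => ?_
      have hl : level (n + unitVec k) = 0 := by rw [level_add_unitVec, hn]; simp
      rw [c.abPowMulZ_of_level_nonpos _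
        (by rw [← neg_add', level_neg, hl, neg_zero]), mul_zero, add_zero, c.iH_x _ _ hl]
      simp only [neg_eq_iff_add_eq_zero]
      split_ifs <;> simp
    | succ s ih =>
      intro n hn
      rw [c.abPowMulZ_eq, sum_apply]
      refine Finset.sum_congr rfl fun k _ => ?_
      have hl : level (n + unitVec k) = -((s + 1 : ℕ) : ℤ) := by
        rw [level_add_unitVec, hn]; push_cast; ring
      have hne : -n ≠ unitVec k := by
        intro h'
        rw [neg_eq_iff_add_eq_zero] at h'
        rw [h', level_zero] at hl
        push_cast at hl
        omega
      rw [if_neg hne, zero_add, Traj.x_eq, c.iH_y _ _ (by rw [hl]; push_cast; omega), map_zero,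
        add_zero, ih _ hl, neg_add']
      rfl
  exact key (-level n - 1).toNat n (by push_cast; omega)

/-- One formula serves all $n$: for $|n|<0$ the output is prescribed to be zero and `abPow` has no
words. -/
theorem iH_y_eq (h : H) (n : Lat d) : (c.iH h).y n = c.C (c.abPow c.A n h) := by
  rcases lt_or_ge (level n) 0 with hn | hn
  · rw [c.iH_y _ _ hn, c.abPow_of_level_neg _ hn]
    simp
  · rw [Traj.y_eq, c.iH_u _ _ hn, c.iH_x_of_level_nonneg _ _ hn, map_zero, add_zero]

theorem iH_u_eq (h : H) (n : Lat d) :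
    (c.iH h).u n = c.B.adjoint (c.abPowMulZ c.A.adjoint (-n) h) := by
  rcases lt_or_ge (level n) 0 with hn | hn
  · rw [Traj.u_eq, c.iH_y _ _ hn, c.iH_next_of_level_neg _ _ hn, map_zero, add_zero]
  · rw [c.iH_u _ _ hn, c.abPowMulZ_of_level_nonpos _ (by rw [level_neg]; omega)]
    simp

/-! ### The series that $\Pi_{dBR}$ assigns to embedded states. -/

/-- The coefficient of `zⁿ` in
`[C (I - Z(z) A)⁻¹ ; B* (I - Z(z)⁻¹ A*)⁻¹ Z(z)⁻¹]`. -/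
def obs (n : Lat d) : H →L[ℂ] WithLp 2 (Es × E) :=
  pairL (c.C ∘L c.abPow c.A n) (c.B.adjoint ∘L c.abPowMulZ c.A.adjoint (-n))

/-- The coefficient of `zⁿ` in
`[C (I - Z(z) A)⁻¹ Z(z) ; B* (I - Z(z)⁻¹ A*)⁻¹]`. -/
def obs' (n : Lat d) : H →L[ℂ] WithLp 2 (Es × E) :=
  pairL (c.C ∘L c.abPowMulZ c.A n) (c.B.adjoint ∘L c.abPow c.A.adjoint (-n))

/-- Since $Z(z)P_k=z_kP_k$, the factor $Z(z)$ acts on $\operatorname{ran}P_k$ as an index shift by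
$e_k$. Hence a single family `obs` restricts to every $H_k$. -/
theorem abPowMulZ_P (X : H →L[ℂ] H) (n : Lat d) (k : Fin d) (h : H) :
    c.abPowMulZ X n (c.P k h) = c.abPow X (n - unitVec k) (c.P k h) := by
  simp only [abPowMulZ, sum_apply, ContinuousLinearMap.comp_apply, P_P_apply]
  rw [Finset.sum_eq_single k]
  · simp
  · intro j _ hj
    simp [hj]
  · simp

theorem obs_comp_P (n : Lat d) (k : Fin d) : c.obs n ∘L c.P k = c.Hcoeff k n := by
  ext1 h
  change WithLp.toLp 2 (c.C (c.abPow c.A n (c.P k h)),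
    c.B.adjoint (c.abPowMulZ c.A.adjoint (-n) (c.P k h))) = _
  rw [abPowMulZ_P, ← neg_add']
  rfl

theorem obs'_comp_P (n : Lat d) (k : Fin d) : c.obs' n ∘L c.P k = c.Hcoeff k (n - unitVec k) := by
  ext1 h
  change WithLp.toLp 2 (c.C (c.abPowMulZ c.A n (c.P k h)),
    c.B.adjoint (c.abPow c.A.adjoint (-n) (c.P k h))) = _
  rw [abPowMulZ_P]
  simp only [Hcoeff, ContinuousLinearMap.comp_apply, sub_add_cancel]
  rfl

theorem dBR_iH (h : H) (n : Lat d) : c.dBR (c.iH h) n = c.obs n h := by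
  change WithLp.toLp 2 ((c.iH h).y n, (c.iH h).u n) = _
  rw [iH_y_eq, iH_u_eq]
  rfl

theorem dBR_shift (m : Lat d) (t : c.Traj) (n : Lat d) :
    c.dBR (c.shift m t) n = c.dBR t (n - m) := rfl

theorem iH'_apply (h : H) : c.iH' h = ∑ k, c.Ucal k (c.iH (c.P k h)) := by
  simp [iH']

theorem iH'_P (k : Fin d) (h : H) : c.iH' (c.P k h) = c.Ucal k (c.iH (c.P k h)) := by
  rw [iH'_apply, Finset.sum_eq_single k]
  · rw [P_P_apply, if_pos rfl]
  · intro j _ hj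
    rw [P_P_apply, if_neg hj, map_zero, map_zero]
  · simp

/-- Checked on each $\operatorname{ran}P_k$ separately: there the shift $\mathcal U_k$ and the
passage from `obs` to `obs'` are both multiplication by $z_k$. -/
theorem dBR_iH' (h : H) (n : Lat d) : c.dBR (c.iH' h) n = c.obs' n h := by
  have h1 : ∀ k, c.dBR (c.Ucal k (c.iH (c.P k h))) n = c.obs' n (c.P k h) := fun k => by
    rw [dBR_shift, dBR_iH, ← ContinuousLinearMap.comp_apply (c.obs' n), obs'_comp_P,
      ← obs_comp_P]
    rfl
  rw [iH'_apply, map_sum, Finset.sum_apply]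
  simp only [h1]
  rw [← map_sum, sum_P_apply]

/-! ### The orthogonal complement of `𝓚_scat-min` -/

theorem inner_eq_inner_Gamma (s t : c.Traj) : ⟪s, t⟫_ℂ = ⟪c.Gamma s, c.Gamma t⟫_ℂ := rfl

theorem inner_iH (h : H) (t : c.Traj) : ⟪c.iH h, t⟫_ℂ = ⟪h, t.x 0⟫_ℂ := by
  rw [inner_eq_inner_Gamma, Gamma_iH]
  simp only [stateData, LinearMap.coe_mk, AddHom.coe_mk, WithLp.prod_inner_apply,
    inner_zero_left, zero_add, add_zero]
  exact lp.inner_single_left (𝕜 := ℂ) (G := fun _ : {n : Lat d // level n = 0} => H) _ _ _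

/-- The trajectory with `u(0) = e` and all the other data on `Ω_0` equal to zero. -/
def iE (e : E) : c.Traj := c.GammaEquiv.symm (WithLp.toLp 2
  (lp.single 2 (⟨0, level_zero.ge⟩ : {n : Lat d // 0 ≤ level n}) e, 0))

theorem Gamma_iE (e : E) : c.Gamma (c.iE e) = WithLp.toLp 2
    (lp.single 2 (⟨0, level_zero.ge⟩ : {n : Lat d // 0 ≤ level n}) e, 0) :=
  c.GammaEquiv.apply_symm_apply _

theorem inner_iE (e : E) (t : c.Traj) : ⟪c.iE e, t⟫_ℂ = ⟪e, t.u 0⟫_ℂ := by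
  rw [inner_eq_inner_Gamma, Gamma_iE]
  simp only [WithLp.prod_inner_apply, inner_zero_left, add_zero]
  exact lp.inner_single_left (𝕜 := ℂ) (G := fun _ : {n : Lat d // 0 ≤ level n} => E) _ _ _

theorem iE_u (e : E) (n : Lat d) (hn : 0 ≤ level n) :
    (c.iE e).u n = if n = 0 then e else 0 := by
  have h1 := congrFun (congrArg Subtype.val (congrArg WithLp.fst (c.Gamma_iE e))) ⟨n, hn⟩
  refine h1.trans ?_
  split_ifs with h0
  · subst h0
    exact lp.single_apply_self (E := fun _ : {n : Lat d // 0 ≤ level n} => E) 2 _ e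
  · exact lp.single_apply_ne (E := fun _ : {n : Lat d // 0 ≤ level n} => E) 2 _ e
      fun h' => h0 (congrArg Subtype.val h')

theorem iE_x (e : E) (n : Lat d) (hn : level n = 0) : (c.iE e).x n = 0 :=
  congrFun (congrArg Subtype.val (congrArg WithLp.fst
    (congrArg WithLp.snd (c.Gamma_iE e)))) ⟨n, hn⟩

theorem iE_y (e : E) (n : Lat d) (hn : level n < 0) : (c.iE e).y n = 0 :=
  congrFun (congrArg Subtype.val (congrArg WithLp.snd
    (congrArg WithLp.snd (c.Gamma_iE e)))) ⟨n, hn⟩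

theorem iE_mem_scatIn (e : E) : c.iE e ∈ c.scatIn :=
  ⟨fun n hn h0 => by rw [iE_u _ _ _ hn, if_neg h0], c.iE_x e, c.iE_y e⟩

/-- Two admissible trajectories with the same data on `Ω_0` coincide. -/
theorem Traj.ext_data {s t : c.Traj} (hu : ∀ n, 0 ≤ level n → s.u n = t.u n)
    (hx : ∀ n, level n = 0 → s.x n = t.x n) (hy : ∀ n, level n < 0 → s.y n = t.y n) : s = t := by
  refine c.Gamma_injective (WithLp.ofLp_injective 2 (Prod.ext
    (Subtype.ext (funext fun n => hu n n.2)) ?_))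
  exact WithLp.ofLp_injective 2 (Prod.ext (Subtype.ext (funext fun n => hx n n.2))
    (Subtype.ext (funext fun n => hy n n.2)))

theorem eq_iE_of_mem_scatIn {t : c.Traj} (ht : t ∈ c.scatIn) : t = c.iE (t.u 0) := by
  refine Traj.ext_data c (fun n hn => ?_) (fun n hn => ?_) fun n hn => ?_
  · rw [iE_u _ _ _ hn]
    split_ifs with h
    · rw [h]
    · exact ht.1 n hn h
  · rw [iE_x _ _ _ hn, ht.2.1 n hn]
  · rw [iE_y _ _ _ hn, ht.2.2 n hn]

/-- The trajectory with `y(0) = v` and all the other data on `Ω_1` equal to zero. -/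
def iEs (v : Es) : c.Traj := c.iH (c.C.adjoint v) + c.iE (c.D.adjoint v)

theorem Traj.u_add (s t : c.Traj) (n : Lat d) : (s + t).u n = s.u n + t.u n := rfl
theorem Traj.x_add (s t : c.Traj) (n : Lat d) : (s + t).x n = s.x n + t.x n := rfl
theorem Traj.y_add (s t : c.Traj) (n : Lat d) : (s + t).y n = s.y n + t.y n := rfl

/-- As $y(0)=Cx(0)+Du(0)$, evaluation of $y$ at the origin is represented by the data $x(0)=C^*v$,
$u(0)=D^*v$. -/
theorem inner_iEs (v : Es) (t : c.Traj) : ⟪c.iEs v, t⟫_ℂ = ⟪v, t.y 0⟫_ℂ := by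
  rw [iEs, inner_add_left, inner_iH, inner_iE, Traj.y_eq, inner_add_right,
    ContinuousLinearMap.adjoint_inner_left, ContinuousLinearMap.adjoint_inner_left]

theorem next_eq_zero_of_level {t : c.Traj} {s : ℤ} (ht : ∀ n, level n = s + 1 → t.x n = 0)
    (n : Lat d) (hn : level n = s) : c.next t.x n = 0 := by
  refine Finset.sum_eq_zero fun k _ => ?_
  rw [ht _ (by rw [level_add_unitVec, hn]), map_zero]

theorem eq_iEs_of_mem_scatOut {t : c.Traj} (ht : t ∈ c.scatOut) : t = c.iEs (t.y 0) := by
  -- Vanishing of $x$ on level $1$ removes the state term from the inverse system, so on level $0$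
  -- the output alone gives $x=C^*y$ and $u=D^*y$.
  have hnext := c.next_eq_zero_of_level (s := 0) (t := t) (by simpa using ht.2.1)
  have hx : ∀ n, level n = 0 → t.x n = c.C.adjoint (t.y n) := fun n hn => by
    conv_lhs => rw [Traj.x_eq, hnext n hn, map_zero, zero_add]
  have hu : ∀ n, level n = 0 → t.u n = c.D.adjoint (t.y n) := fun n hn => by
    conv_lhs => rw [Traj.u_eq, hnext n hn, map_zero, zero_add]
  refine Traj.ext_data c (fun n hn => ?_) (fun n hn => ?_) fun n hn => ?_
  · rw [iEs, Traj.u_add, c.iH_u _ _ hn, iE_u _ _ _ hn, zero_add]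
    split_ifs with h
    · rw [h, hu 0 level_zero]
    · rcases hn.eq_or_lt with h0 | h0
      · rw [hu n h0.symm, ht.2.2 n (by omega) h, map_zero]
      · exact ht.1 n (by omega)
  · rw [iEs, Traj.x_add, c.iH_x _ _ hn, iE_x _ _ _ hn, add_zero]
    split_ifs with h
    · rw [h, hx 0 level_zero]
    · rw [hx n hn, ht.2.2 n (by omega) h, map_zero]
  · rw [iEs, Traj.y_add, c.iH_y _ _ hn, iE_y _ _ _ hn, add_zero,
      ht.2.2 n (by omega) (by rintro rfl; rw [level_zero] at hn; omega)]

theorem iEs_mem_scatOut (v : Es) : c.iEs v ∈ c.scatOut := by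
  -- The level-$0$ data are $U^{-1}(0,v)$ at the origin and zero elsewhere; applying $U$ gives zero
  -- next state and the required output.
  have hd : ∀ n, level n = 0 → (WithLp.toLp 2 ((c.iEs v).x n, (c.iEs v).u n) : WithLp 2 (H × E)) =
      c.U.symm (WithLp.toLp 2 (0, if n = 0 then v else 0)) := fun n hn => by
    rw [U_symm_apply, iEs, Traj.u_add, Traj.x_add, c.iH_u _ _ hn.ge, c.iE_u _ _ hn.ge,
      c.iH_x _ _ hn, c.iE_x _ _ hn]
    split_ifs <;> simp
  have hs : ∀ n, level n = 0 → c.next (c.iEs v).x n = 0 ∧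
      (c.iEs v).y n = if n = 0 then v else 0 := fun n hn => by
    have h := Traj.system c (c.iEs v) n
    rw [hd n hn, LinearIsometryEquiv.apply_symm_apply] at h
    exact ⟨(congrArg WithLp.fst h).symm, (congrArg WithLp.snd h).symm⟩
  refine ⟨fun n hn => ?_, fun n hn => ?_, fun n hn h0 => ?_⟩
  · have hn0 : n ≠ 0 := by
      rintro rfl
      rw [level_zero] at hn
      omega
    rw [iEs, Traj.u_add, c.iH_u _ _ (by omega), c.iE_u _ _ (by omega), if_neg hn0, add_zero]
  · rw [← c.sum_P_next (c.iEs v).x n]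
    refine Finset.sum_eq_zero fun k _ => ?_
    rw [(hs _ (by rw [level_sub_unitVec]; omega)).1, map_zero]
  · rcases (show level n ≤ 0 by omega).eq_or_lt with h | h
    · rw [(hs n h).2, if_neg h0]
    · rw [iEs, Traj.y_add, c.iH_y _ _ h, c.iE_y _ _ h, add_zero]

theorem inner_shift_left (m : Lat d) (s t : c.Traj) :
    ⟪c.shift m s, t⟫_ℂ = ⟪s, c.shift (-m) t⟫_ℂ := by
  have h : t = c.shift m (c.shift (-m) t) :=
    ((c.shiftL_shiftL m (-m) t).trans (by rw [add_neg_cancel, shiftL_zero])).symm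
  conv_lhs => rw [h]
  exact LinearIsometryEquiv.inner_map_map _ _ _

theorem shift_u (m : Lat d) (t : c.Traj) (n : Lat d) : (c.shift m t).u n = t.u (n - m) := rfl
theorem shift_x (m : Lat d) (t : c.Traj) (n : Lat d) : (c.shift m t).x n = t.x (n - m) := rfl
theorem shift_y (m : Lat d) (t : c.Traj) (n : Lat d) : (c.shift m t).y n = t.y (n - m) := rfl

/-- Pairing $t$ with $\mathcal U^n$ of `iE e` reads off $u(n)$, and pairing with $\mathcal U^n$ of
`iEs v` reads off $y(n)$; these vectors exhaust the shifted scattering spaces. -/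
theorem mem_scatMin_orthogonal {t : c.Traj} : t ∈ c.scatMinᗮ ↔ c.dBR t = 0 := by
  rw [scatMin, Submodule.orthogonal_closure, ← Submodule.iInf_orthogonal]
  simp only [← Submodule.inf_orthogonal, Submodule.mem_iInf, Submodule.mem_inf,
    Submodule.mem_orthogonal, Submodule.mem_map]
  constructor
  · intro h
    have hu : ∀ n, t.u n = 0 := fun n => ext_inner_left ℂ fun e => by
      have := (h n).1 _ ⟨_, c.iE_mem_scatIn e, rfl⟩
      change ⟪c.shift n _, t⟫_ℂ = 0 at this
      rw [inner_shift_left, inner_iE, shift_u, zero_sub, neg_neg] at this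
      rw [this, inner_zero_right]
    have hy : ∀ n, t.y n = 0 := fun n => ext_inner_left ℂ fun e => by
      have := (h n).2 _ ⟨_, c.iEs_mem_scatOut e, rfl⟩
      change ⟪c.shift n _, t⟫_ℂ = 0 at this
      rw [inner_shift_left, inner_iEs, shift_y, zero_sub, neg_neg] at this
      rw [this, inner_zero_right]
    funext n
    change WithLp.toLp 2 (t.y n, t.u n) = _
    rw [hu, hy]
    rfl
  · intro h
    have hu : ∀ n, t.u n = 0 := fun n => congrArg WithLp.snd (congrFun h n)
    have hy : ∀ n, t.y n = 0 := fun n => congrArg WithLp.fst (congrFun h n)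
    refine fun n => ⟨?_, ?_⟩
    · rintro _ ⟨s, hs, rfl⟩
      change ⟪c.shift n s, t⟫_ℂ = 0
      rw [c.eq_iE_of_mem_scatIn hs, inner_shift_left, inner_iE, shift_u, hu, inner_zero_right]
    · rintro _ ⟨s, hs, rfl⟩
      change ⟪c.shift n s, t⟫_ℂ = 0
      rw [c.eq_iEs_of_mem_scatOut hs, inner_shift_left, inner_iEs, shift_y, hy, inner_zero_right]

/-! ### Isometric embeddings of the state space -/

theorem inner_P_left (k : Fin d) (g h : H) : ⟪c.P k g, h⟫_ℂ = ⟪g, c.P k h⟫_ℂ := by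
  rw [← ContinuousLinearMap.adjoint_inner_left, ← ContinuousLinearMap.star_eq_adjoint, star_P]

theorem adjoint_P (k : Fin d) : (c.P k).adjoint = c.P k := c.star_P k

/-- The left side samples the state of $i_{\mathcal H}(P_kh)$ at $e_j-e_k$, a point of level $0$
that is the origin only for $j=k$. For $j\ne k$ both sides vanish. -/
theorem inner_iH'_term (j k : Fin d) (g h : H) :
    ⟪c.Ucal j (c.iH (c.P j g)), c.Ucal k (c.iH (c.P k h))⟫_ℂ = ⟪c.P j g, c.P k h⟫_ℂ := by
  rw [inner_shift_left, inner_iH, shift_x, shift_x, c.iH_x]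
  · by_cases hjk : j = k
    · subst hjk
      simp
    · rw [inner_P_left c j g (c.P k h), P_P_apply, if_neg hjk, if_neg]
      · simp
      · intro h0
        have h1 := congrFun h0 j
        simp [unitVec, hjk] at h1
  · rw [level_sub_unitVec, level_sub, level_neg, level_unitVec, level_zero]
    norm_num

theorem norm_iH' (h : H) : ‖c.iH' h‖ = ‖h‖ := by
  have h1 : ⟪c.iH' h, c.iH' h⟫_ℂ = ⟪h, h⟫_ℂ := by
    rw [iH'_apply, sum_inner]
    simp only [inner_sum, inner_iH'_term]
    simp only [← inner_sum, sum_P_apply]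
    rw [← sum_inner, sum_P_apply]
  rw [norm_eq_sqrt_re_inner (𝕜 := ℂ), norm_eq_sqrt_re_inner (𝕜 := ℂ), h1]

/-- `i_𝓗` as a linear isometry. -/
def iHIsometry : H →ₗᵢ[ℂ] c.Traj := ⟨c.iH, c.norm_iH⟩

/-- `i'_𝓗` as a linear isometry. -/
def iHIsometry' : H →ₗᵢ[ℂ] c.Traj := ⟨c.iH', c.norm_iH'⟩

/-! ### The common argument for an isometry $i$ and its coefficient family $T$. -/

variable {c}

/-- The coefficient formula is asked only on the orthogonal complement: for the family $T_nP_k$ it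
is available there because $P_kh=h$. -/
theorem isUnitaryOnto_map {i : H →ₗᵢ[ℂ] c.Traj} {T : Lat d → H →L[ℂ] WithLp 2 (Es × E)}
    {K : PosKernel d (WithLp 2 (Es × E))} (hK : ∀ n m, K.coeff n m = T n ∘L (T m).adjoint)
    (hT : ∀ h ∈ (commonKer T)ᗮ, ∀ n, c.dBR (i h) n = T n h) :
    c.IsUnitaryOnto ((commonKer T)ᗮ.map i.toLinearMap) K := by
  obtain ⟨Φ, hΦ⟩ := exists_isometryEquiv_FRKHS T K hK
  let e : (commonKer T)ᗮ ≃ₗᵢ[ℂ] (commonKer T)ᗮ.map i.toLinearMap :=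
    ⟨Submodule.equivMapOfInjective i.toLinearMap i.injective _, fun x => i.norm_map x⟩
  refine ⟨e.symm.trans Φ, fun t => funext fun n => ?_⟩
  obtain ⟨x, rfl⟩ := e.surjective t
  rw [LinearIsometryEquiv.trans_apply, e.symm_apply_apply, hΦ, ← hT x x.2 n]
  rfl

variable {i : H →ₗᵢ[ℂ] c.Traj} {T : Lat d → H →L[ℂ] WithLp 2 (Es × E)}
  {K : Fin d → PosKernel d (WithLp 2 (Es × E))} {M : Fin d → Submodule ℂ c.Traj}

/-- Because $\sum_kP_k=I$, the sum $\sum_kT_nP_kP_kT_m^*$ collapses to $T_nT_m^*$. -/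
theorem isUnitaryOnto_sum (hT : ∀ h n, c.dBR (i h) n = T n h)
    (hK : ∀ k n m, (K k).coeff n m = (T n ∘L c.P k) ∘L (T m ∘L c.P k).adjoint) :
    c.IsUnitaryOnto ((commonKer T)ᗮ.map i.toLinearMap) (PosKernel.sum K) := by
  refine isUnitaryOnto_map (fun n m => ?_) fun h _ n => hT h n
  change (∑ k, (K k).coeff) n m = _
  rw [Matrix.sum_apply]
  ext1 v
  simp only [hK, ContinuousLinearMap.adjoint_comp, adjoint_P, sum_apply,
    ContinuousLinearMap.comp_apply, P_P_apply, if_true]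
  rw [← map_sum, sum_P_apply]

theorem isUnitaryOnto_ominus (hT : ∀ h n, c.dBR (i h) n = T n h)
    (hM : ∀ k, M k = (LinearMap.range (c.P k).toLinearMap).map i.toLinearMap)
    (hK : ∀ k n m, (K k).coeff n m = (T n ∘L c.P k) ∘L (T m ∘L c.P k).adjoint) (k : Fin d) :
    c.IsUnitaryOnto (ominus (M k) (M k ⊓ c.scatMinᗮ)) (K k) := by
  -- $(I-P_k)h$ is annihilated by every $T_nP_k$, hence orthogonal to $h$; it is also orthogonal to
  -- $P_kh$, so it is zero.
  have hN : ∀ h ∈ (commonKer fun n => T n ∘L c.P k)ᗮ, c.P k h = h := fun h hh => by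
    have h1 : h - c.P k h ∈ commonKer fun n => T n ∘L c.P k := mem_commonKer.2 fun n => by
      simp [P_P_apply]
    have h2 := (Submodule.mem_orthogonal _ _).1 hh _ h1
    have h3 : ⟪h - c.P k h, c.P k h⟫_ℂ = 0 := by
      rw [← inner_P_left, map_sub, P_P_apply, if_pos rfl, sub_self, inner_zero_left]
    rw [← sub_eq_zero, ← norm_eq_zero, norm_sub_rev, norm_eq_zero,
      ← inner_self_eq_zero (𝕜 := ℂ), inner_sub_right, h2, h3, sub_zero]
  have hmem : ∀ h, i (c.P k h) ∈ c.scatMinᗮ ↔ h ∈ commonKer fun n => T n ∘L c.P k := fun h => by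
    rw [mem_scatMin_orthogonal, mem_commonKer, funext_iff]
    simp only [hT]
    rfl
  have heq : ominus (M k) (M k ⊓ c.scatMinᗮ) =
      (commonKer fun n => T n ∘L c.P k)ᗮ.map i.toLinearMap := by
    ext t
    simp only [ominus, hM k]
    constructor
    · rintro ⟨⟨_, ⟨h, rfl⟩, rfl⟩, ht⟩
      refine ⟨c.P k h, (Submodule.mem_orthogonal _ _).2 fun g hg => ?_, rfl⟩
      have := (Submodule.mem_orthogonal _ _).1 ht (i (c.P k g)) ⟨⟨_, ⟨g, rfl⟩, rfl⟩, (hmem g).2 hg⟩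
      rw [← inner_P_left, ← this]
      change _ = ⟪i _, i (c.P k h)⟫_ℂ
      rw [i.inner_map_map, inner_P_left, inner_P_left, P_P_apply, if_pos rfl]
    · rintro ⟨h, hh, rfl⟩
      refine ⟨⟨h, ⟨h, hN h hh⟩, rfl⟩, (Submodule.mem_orthogonal _ _).2 ?_⟩
      rintro _ ⟨⟨_, ⟨g, rfl⟩, rfl⟩, hg⟩
      have := (Submodule.mem_orthogonal _ _).1 hh g ((hmem g).1 hg)
      change ⟪i (c.P k g), i h⟫_ℂ = 0
      rw [i.inner_map_map, inner_P_left, hN h hh, this]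
  rw [heq]
  refine isUnitaryOnto_map (hK k) fun h hh n => ?_
  rw [hT, ContinuousLinearMap.comp_apply, hN h hh]

/-- A vector $h$ of the common kernel splits into the series of the $P_kh$, whose sum is zero;
conversely an overlapping family glues to a vector of the common kernel. -/
theorem overlappingSpace_eq_bot_iff
    (hK : ∀ k n m, (K k).coeff n m = (T n ∘L c.P k) ∘L (T m ∘L c.P k).adjoint) :
    overlappingSpace K = ⊥ ↔ ∀ k, ∀ h ∈ commonKer T, c.P k h ∈ commonKer T := by
  have hmem : ∀ f : PiLp 2 (fun j => FRKHS (K j)), f ∈ overlappingSpace K ↔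
      ∀ n, ∑ k, f k n = 0 := fun f => by
    change (∑ k, ⇑(f k)) = 0 ↔ _
    simp [funext_iff]
  constructor
  · intro h0 k h hh
    choose f hf using fun k => exists_FRKHS_eq (fun n => T n ∘L c.P k) (K k) (hK k) h
    have hov : (WithLp.toLp 2 f : PiLp 2 (fun j => FRKHS (K j))) ∈ overlappingSpace K := by
      rw [hmem]
      intro n
      simp only [hf, ContinuousLinearMap.comp_apply]
      rw [← map_sum, sum_P_apply, mem_commonKer.1 hh]
    rw [h0, Submodule.mem_bot] at hov
    refine mem_commonKer.2 fun n => ?_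
    have hk : f k = 0 := congrArg (fun g : PiLp 2 (fun j => FRKHS (K j)) => g k) hov
    have := hf k n
    rw [hk, RKHS.coe_zero] at this
    exact this.symm
  · intro hinv
    rw [Submodule.eq_bot_iff]
    intro f hf
    rw [hmem] at hf
    choose h hh using fun k => (f k).exists_eq (fun n => T n ∘L c.P k) (K k) (hK k)
    -- The representatives $h_k$ of the series $f_k$ are glued to $\sum_jP_jh_j$, whose $k$-th
    -- component still represents $f_k$.
    have hP : ∀ k, c.P k (∑ j, c.P j (h j)) = c.P k (h k) := fun k => by
      simp [map_sum, P_P_apply]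
    have hmemh : ∑ j, c.P j (h j) ∈ commonKer T := mem_commonKer.2 fun n => by
      rw [map_sum, ← hf n]
      simp only [hh]
      rfl
    refine PiLp.ext fun k => RKHS.ext fun n => ?_
    have := mem_commonKer.1 (hinv k _ hmemh) n
    rw [hP] at this
    exact (hh k n).trans (this.trans (congrFun RKHS.coe_zero n).symm)

theorem starProjection_map_range_P
    (hM : ∀ k, M k = (LinearMap.range (c.P k).toLinearMap).map i.toLinearMap)
    [∀ k, (M k).HasOrthogonalProjection] (k : Fin d) (h : H) :
    (M k).starProjection (i h) = i (c.P k h) := by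
  refine Submodule.eq_starProjection_of_mem_orthogonal (K := M k) ?_ ?_
  · rw [hM]
    exact ⟨_, ⟨h, rfl⟩, rfl⟩
  · rw [hM, Submodule.mem_orthogonal]
    rintro _ ⟨_, ⟨g, rfl⟩, rfl⟩
    change ⟪i (c.P k g), _⟫_ℂ = 0
    rw [← map_sub, i.inner_map_map, inner_P_left, map_sub, P_P_apply, if_pos rfl, sub_self,
      inner_zero_right]

theorem invariantUnder_map_iff
    (hM : ∀ k, M k = (LinearMap.range (c.P k).toLinearMap).map i.toLinearMap)
    [∀ k, (M k).HasOrthogonalProjection] (N : Submodule ℂ H) :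
    InvariantUnder (N.map i.toLinearMap) M ↔ ∀ k, ∀ h ∈ N, c.P k h ∈ N := by
  refine forall_congr' fun k => ⟨fun H h hh => ?_, ?_⟩
  · have := H (i h) ⟨h, hh, rfl⟩
    rw [starProjection_map_range_P hM] at this
    obtain ⟨g, hg, hgh⟩ := this
    rwa [← i.injective hgh]
  · rintro H _ ⟨h, hh, rfl⟩
    change (M k).starProjection (i h) ∈ _
    rw [starProjection_map_range_P hM]
    exact ⟨_, H h hh, rfl⟩

/-- Self-adjointness of $P_k$ passes invariance to the orthogonal complement. -/
theorem forall_P_mem_orthogonal {N : Submodule ℂ H} (hN : ∀ k, ∀ h ∈ N, c.P k h ∈ N) (k : Fin d)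
    (h : H) (hh : h ∈ Nᗮ) : c.P k h ∈ Nᗮ := by
  rw [Submodule.mem_orthogonal] at hh ⊢
  intro g hg
  rw [← inner_P_left]
  exact hh _ (hN k g hg)

theorem iSup_inf_scatMin_orthogonal (hT : ∀ h n, c.dBR (i h) n = T n h)
    (hM : ∀ k, M k = (LinearMap.range (c.P k).toLinearMap).map i.toLinearMap) :
    (⨆ k, M k) ⊓ c.scatMinᗮ = (commonKer T).map i.toLinearMap := by
  have h1 : (⨆ k, LinearMap.range (c.P k).toLinearMap) = ⊤ := by
    refine eq_top_iff.2 fun h _ => ?_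
    rw [← c.sum_P_apply h]
    exact Submodule.sum_mem _ fun k _ => Submodule.mem_iSup_of_mem k ⟨h, rfl⟩
  have h2 : ∀ h, i h ∈ c.scatMinᗮ ↔ h ∈ commonKer T := fun h => by
    rw [mem_scatMin_orthogonal, mem_commonKer, funext_iff]
    simp only [hT]
    rfl
  simp only [hM]
  rw [← Submodule.map_iSup, h1]
  ext t
  constructor
  · rintro ⟨⟨h, _, rfl⟩, ht⟩
    exact ⟨h, (h2 h).1 ht, rfl⟩
  · rintro ⟨h, hh, rfl⟩
    exact ⟨⟨h, trivial, rfl⟩, (h2 h).2 hh⟩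

theorem overlappingSpace_eq_bot_iff_invariantUnder (hT : ∀ h n, c.dBR (i h) n = T n h)
    (hM : ∀ k, M k = (LinearMap.range (c.P k).toLinearMap).map i.toLinearMap)
    (hK : ∀ k n m, (K k).coeff n m = (T n ∘L c.P k) ∘L (T m ∘L c.P k).adjoint)
    [∀ k, (M k).HasOrthogonalProjection] :
    (overlappingSpace K = ⊥ ↔ InvariantUnder ((⨆ k, M k) ⊓ c.scatMinᗮ) M) ∧
    (overlappingSpace K = ⊥ ↔ InvariantUnder ((commonKer T)ᗮ.map i.toLinearMap) M) := by
  rw [iSup_inf_scatMin_orthogonal hT hM, invariantUnder_map_iff hM, invariantUnder_map_iff hM,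
    overlappingSpace_eq_bot_iff hK]
  refine ⟨Iff.rfl, forall_P_mem_orthogonal, fun h => ?_⟩
  have := forall_P_mem_orthogonal h
  -- The common kernel is closed, so taking complements twice returns to it.
  rwa [Submodule.orthogonal_orthogonal] at this

/-! ### Matching $\mathcal H_{scc}$, $\mathcal H_{sscc}$, $\mathcal U_k\mathcal L_k$ and the kernels
with the common argument. -/

variable (c)

/-- The complement of the span of the generating ranges is the intersection of the kernels of the
adjoints, and these are the coefficients of `obs`. -/
theorem Hscc_eq : c.Hscc = (commonKer c.obs)ᗮ := by
  rw [Hscc, ← Submodule.orthogonal_orthogonal_eq_closure, ← Submodule.iInf_orthogonal]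
  congr 1
  ext h
  simp only [← Submodule.inf_orthogonal, Submodule.mem_iInf, Submodule.mem_inf,
    ContinuousLinearMap.orthogonal_range, mem_commonKer]
  change (∀ n, ((c.abPow c.A n).adjoint ∘L c.C.adjoint).adjoint h = 0 ∧
    (c.abPowMulZ c.A n ∘L c.B).adjoint h = 0) ↔
    ∀ n, WithLp.toLp 2 (c.C (c.abPow c.A n h),
      c.B.adjoint (c.abPowMulZ c.A.adjoint (-n) h)) = 0
  simp only [ContinuousLinearMap.adjoint_comp, ContinuousLinearMap.adjoint_adjoint,
    adjoint_abPowMulZ, ContinuousLinearMap.comp_apply, WithLp.toLp_eq_zero, Prod.mk_eq_zero]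
  rw [forall_and, forall_and]
  -- The generators built from $B$ are indexed by $n$, while `obs` uses the exponent $-n$;
  -- quantifying over the whole lattice absorbs the sign.
  exact and_congr_right fun _ => ⟨fun H n => H (-n), fun H n => by simpa using H (-n)⟩

theorem Hsscc_eq : c.Hsscc = (commonKer c.obs')ᗮ := by
  rw [Hsscc, ← Submodule.orthogonal_orthogonal_eq_closure, ← Submodule.iInf_orthogonal]
  congr 1
  ext h
  simp only [← Submodule.inf_orthogonal, Submodule.mem_iInf, Submodule.mem_inf,
    ContinuousLinearMap.orthogonal_range, mem_commonKer]
  change (∀ n, (c.abPowMulZ c.A.adjoint n ∘L c.C.adjoint).adjoint h = 0 ∧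
    ((c.abPow c.A.adjoint n).adjoint ∘L c.B).adjoint h = 0) ↔
    ∀ n, WithLp.toLp 2 (c.C (c.abPowMulZ c.A n h),
      c.B.adjoint (c.abPow c.A.adjoint (-n) h)) = 0
  simp only [ContinuousLinearMap.adjoint_comp, ContinuousLinearMap.adjoint_adjoint,
    adjoint_abPowMulZ, ContinuousLinearMap.comp_apply, WithLp.toLp_eq_zero, Prod.mk_eq_zero]
  rw [forall_and, forall_and]
  exact and_congr_right fun _ => ⟨fun H n => H (-n), fun H n => by simpa using H (-n)⟩

theorem Lk'_eq_map (k : Fin d) :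
    c.Lk' k = (LinearMap.range (c.P k).toLinearMap).map c.iHIsometry'.toLinearMap := by
  rw [Lk', Lk_eq_map]
  ext t
  constructor
  · rintro ⟨_, ⟨_, ⟨h, rfl⟩, rfl⟩, rfl⟩
    exact ⟨_, ⟨h, rfl⟩, c.iH'_P k h⟩
  · rintro ⟨_, ⟨h, rfl⟩, rfl⟩
    exact ⟨_, ⟨_, ⟨h, rfl⟩, rfl⟩, (c.iH'_P k h).symm⟩

theorem Kk_coeff (k : Fin d) (n m : Lat d) :
    (c.Kk k).coeff n m = (c.obs n ∘L c.P k) ∘L (c.obs m ∘L c.P k).adjoint := by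
  rw [obs_comp_P, obs_comp_P]
  rfl

theorem Kk'_coeff (k : Fin d) (n m : Lat d) :
    (c.Kk' k).coeff n m = (c.obs' n ∘L c.P k) ∘L (c.obs' m ∘L c.P k).adjoint := by
  rw [obs'_comp_P, obs'_comp_P]
  rfl

end Colligation

end

end GivoneRoesser

theorem proposition6p8 {d : ℕ} {H E Es : Type*}
    [NormedAddCommGroup H] [InnerProductSpace ℂ H] [CompleteSpace H]
    [NormedAddCommGroup E] [InnerProductSpace ℂ E] [CompleteSpace E]
    [NormedAddCommGroup Es] [InnerProductSpace ℂ Es] [CompleteSpace Es]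
    (c : GivoneRoesser.Colligation d H E Es) :
    (c.IsUnitaryOnto c.Lscc c.Ksum ∧
      (∀ k, c.IsUnitaryOnto (GivoneRoesser.ominus (c.Lk k) (c.Lk k ⊓ c.scatMinᗮ)) (c.Kk k)) ∧
      c.IsUnitaryOnto c.Lsscc c.Ksum' ∧
      ∀ k, c.IsUnitaryOnto (GivoneRoesser.ominus (c.Lk' k) (c.Lk' k ⊓ c.scatMinᗮ)) (c.Kk' k)) ∧
    ((GivoneRoesser.overlappingSpace c.Kk = ⊥ ↔
        GivoneRoesser.InvariantUnder (c.L ⊓ c.scatMinᗮ) c.Lk) ∧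
      (GivoneRoesser.overlappingSpace c.Kk = ⊥ ↔
        GivoneRoesser.InvariantUnder c.Lscc c.Lk)) ∧
    ((GivoneRoesser.overlappingSpace c.Kk' = ⊥ ↔
        GivoneRoesser.InvariantUnder (c.L' ⊓ c.scatMinᗮ) c.Lk') ∧
      (GivoneRoesser.overlappingSpace c.Kk' = ⊥ ↔
        GivoneRoesser.InvariantUnder c.Lsscc c.Lk')) := by
  have hT : ∀ h n, c.dBR (c.iHIsometry h) n = c.obs n h := c.dBR_iH
  have hT' : ∀ h n, c.dBR (c.iHIsometry' h) n = c.obs' n h := c.dBR_iH'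
  have hM : ∀ k, c.Lk k = (LinearMap.range (c.P k).toLinearMap).map c.iHIsometry.toLinearMap :=
    c.Lk_eq_map
  have hL : c.Lscc = (GivoneRoesser.commonKer c.obs)ᗮ.map c.iHIsometry.toLinearMap := by
    rw [← c.Hscc_eq]; rfl
  have hL' : c.Lsscc = (GivoneRoesser.commonKer c.obs')ᗮ.map c.iHIsometry'.toLinearMap := by
    rw [← c.Hsscc_eq]; rfl
  rw [hL, hL']
  exact ⟨⟨GivoneRoesser.Colligation.isUnitaryOnto_sum hT c.Kk_coeff,
      GivoneRoesser.Colligation.isUnitaryOnto_ominus hT hM c.Kk_coeff,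
      GivoneRoesser.Colligation.isUnitaryOnto_sum hT' c.Kk'_coeff,
      GivoneRoesser.Colligation.isUnitaryOnto_ominus hT' c.Lk'_eq_map c.Kk'_coeff⟩,
    GivoneRoesser.Colligation.overlappingSpace_eq_bot_iff_invariantUnder hT hM c.Kk_coeff,
    GivoneRoesser.Colligation.overlappingSpace_eq_bot_iff_invariantUnder hT' c.Lk'_eq_map
      c.Kk'_coeff⟩
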